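/- Let $N=2n$ be an even number of sites, $\nu\ge 1$, and $1\le \ell\le\nu$. Each site $i\in\{1,\dots,N\}$ carries $\nu+1$ qubits $(i,0),\dots,(i,\nu)$ with Pauli operators $X_i^{(m)},Y_i^{(m)},Z_i^{(m)}$. Put $S_i=\prod_{j<i}\prod_{m=0}^{\nu}Z_j^{(m)}$, $Z_{i,<\ell}=\prod_{m<\ell}Z_i^{(m)}$, $Z_{i,\le\nu}=\prod_{m=0}^{\nu}Z_i^{(m)}$ and define the Jordan--Wigner modes and Majorana operators $$b_i^{(\ell)}=S_iZ_{i,<\ell}\tfrac{X_i^{(\ell)}-iY_i^{(\ell)}}{2},\qquad c_i=b_i^{(\ell)}+b_i^{(\ell)\dagger},\qquad d_i=-i\bigl(b_i^{(\ell)}-b_i^{(\ell)\dagger}\bigr),$$ the stabilizers $P_{ij}=i\,c_id_j$, and the ordered operator $$\mathcal C_{\mathrm{ord}}^{(\ell)}=2^{-N/4}(c_1-id_2)(c_3-id_4)\cdots(c_{N-1}-id_N).$$ (1) Locality. For $1\le k\le N/2$ let $$\tilde c_{2k-1}=Z_{2k-1,<\ell}\,X^{(\ell)}_{2k-1}\,(Z_{2k-1,\le\nu}Z_{2k,\le\nu})^{N/2-k},\qquad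 \tilde d_{2k}=-Z_{2k-1,\le\nu}\,Z_{2k,<\ell}\,Y^{(\ell)}_{2k}\,(Z_{2k-1,\le\nu}Z_{2k,\le\nu})^{N/2-k}.$$ Then $\mathcal C_{\mathrm{ord}}^{(\ell)}=2^{-N/4}\prod_{k=1}^{N/2}(\tilde c_{2k-1}-i\tilde d_{2k})$. The operators $\tilde c_{2k-1},\tilde d_{2k}$ act only on the qubits of the sites $2k-1,2k$, so that their Pauli weights are at most $2(\nu+1)$ and different $k$ involve disjoint sets of qubits. (2) Unitary embedding. Add $N/2$ ancilla qubits and let $$\tilde{\mathcal U}_k=|0\rangle\langle0|_{\mathrm{anc},k}\,\tilde c_{2k-1}+|1\rangle\langle1|_{\mathrm{anc},k}\,(-i\tilde d_{2k}),\qquad \mathcal U_{\mathrm{ord}}=\prod_{k=1}^{N/2}\tilde{\mathcal U}_k.$$ Each $\tilde{\mathcal U}_k$ is unitary and acts only on the $k$-th ancilla and the qubits of the sites $2k-1,2k$; these sets of qubits are disjoint for different $k$. Hence $\mathcal U_{\mathrm{ord}}$ and $W=\mathrm H_{\mathrm{anc}}\,\mathcal U_{\mathrm{ord}}\,\mathrm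 H_{\mathrm{anc}}$ are unitary, where $\mathrm H_{\mathrm{anc}}$ applies a Hadamard gate to every ancilla. (3) Measurement and sign correction. For every system state $\psi$ and every outcome $m\in\{0,1\}^{N/2}$ of a computational-basis measurement of the ancillas in the state $W(|0\cdots0\rangle_{\mathrm{anc}}\otimes\psi)$, the (unnormalized) resulting system state is $$\psi_m=2^{-N/2}\Bigl[\prod_{k=1}^{N/2}\bigl(c_{2k-1}-(-1)^{m_k}i\,d_{2k}\bigr)\Bigr]\psi ,$$ and it satisfies $(-1)^{m_k}P_{2k-1,2k}\,\psi_m=\psi_m$ for every $k$, i.e. it is stabilized by the sign-corrected stabilizers. In particular $\psi_{0}=2^{-N/4}\,\mathcal C_{\mathrm{ord}}^{(\ell)}\psi$. (4) Depth. There is an absolute constant $K$ (independent of $N$, $\nu$, $\ell$) such that $\mathcal U_{\mathrm{ord}}$ and $W$ are each implemented exactly, on the $N(\nu+1)$ system qubits and the $N/2$ ancillas without any further qubits, by a circuit of depth at most $K(1+\log\nu)$ consisting of Hadamard, $X$, CNOT and CZ gates between arbitrary pairs of qubits; depth is the number of layers of gates acting on disjoint qubits. -/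

import Mathlib

open Matrix

noncomputable section

namespace OrderedPrep

/-! ### Qubit registers and operators -/

/-- Computational basis labels of a register of qubits indexed by `Q`. -/
abbrev Basis (Q : Type) : Type := Q → Fin 2

/-- Operators on the Hilbert space `(ℂ²)^{⊗ Q}`, as matrices in the computational basis. -/
abbrev Op (Q : Type) : Type := Matrix (Basis Q) (Basis Q) ℂ

/-- State vectors (not necessarily normalized) in `(ℂ²)^{⊗ Q}`. -/
abbrev Ket (Q : Type) : Type := Basis Q → ℂ

def matX : Matrix (Fin 2) (Fin 2) ℂ := !![0, 1; 1, 0]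
def matY : Matrix (Fin 2) (Fin 2) ℂ := !![0, -Complex.I; Complex.I, 0]
def matZ : Matrix (Fin 2) (Fin 2) ℂ := !![1, 0; 0, -1]
def matH : Matrix (Fin 2) (Fin 2) ℂ := ((Real.sqrt 2 : ℝ) : ℂ)⁻¹ • !![1, 1; 1, -1]
/-- `|0⟩⟨0|` -/
def proj0 : Matrix (Fin 2) (Fin 2) ℂ := !![1, 0; 0, 0]
/-- `|1⟩⟨1|` -/
def proj1 : Matrix (Fin 2) (Fin 2) ℂ := !![0, 0; 0, 1]

section Register

variable {Q : Type} [Fintype Q] [DecidableEq Q]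

/-- The single-qubit operator `A` on qubit `q`, tensored with the identity on all others. -/
def onQubit (A : Matrix (Fin 2) (Fin 2) ℂ) (q : Q) : Op Q :=
  Matrix.of fun x y => if ∀ r, r ≠ q → x r = y r then A (x q) (y q) else 0

/-- The product of the Pauli `Z` operators on the qubits in `T` (they commute, so the order in
which the list enumerates `T` is irrelevant). -/
def zString (T : Finset Q) : Op Q := (T.toList.map fun q => onQubit matZ q).prod

/-- `A` acts only on the qubits in `T`: `A = B ⊗ 1` with `B` an operator on the qubits in `T`. -/
def SupportedOn (A : Op Q) (T : Finset Q) : Prop :=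
  ∃ B : Matrix ({q // q ∈ T} → Fin 2) ({q // q ∈ T} → Fin 2) ℂ, ∀ x y : Basis Q,
    A x y = if ∀ q, q ∉ T → x q = y q then B (fun q => x q) (fun q => y q) else 0

/-- The weight of `A`: the number of qubits on which it acts non-trivially. -/
def weight (A : Op Q) : ℕ := Set.ncard {q : Q | ¬ SupportedOn A (Finset.univ.erase q)}

/-- The operator `|0⟩⟨0|_c ⊗ 1 + |1⟩⟨1|_c ⊗ A_t`, for `c ≠ t`. -/
def controlled (A : Matrix (Fin 2) (Fin 2) ℂ) (c t : Q) : Op Q :=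
  onQubit proj0 c + onQubit proj1 c * onQubit A t

end Register

/-! ### Circuits and depth -/

/-- The elementary gates: Hadamard, Pauli `X`, `CNOT` and `CZ`, between arbitrary qubits. -/
inductive Gate (Q : Type) : Type
  | had (q : Q) : Gate Q
  | x (q : Q) : Gate Q
  | cx (c t : Q) (h : c ≠ t) : Gate Q
  | cz (c t : Q) (h : c ≠ t) : Gate Q

section Circuits

variable {Q : Type} [Fintype Q] [DecidableEq Q]

/-- The qubits a gate touches. -/
def Gate.qubits : Gate Q → Finset Q
  | .had q => {q}
  | .x q => {q}
  | .cx c t _ => {c, t}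
  | .cz c t _ => {c, t}

/-- The unitary of a gate. -/
def Gate.op : Gate Q → Op Q
  | .had q => onQubit matH q
  | .x q => onQubit matX q
  | .cx c t _ => controlled matX c t
  | .cz c t _ => controlled matZ c t

/-- A layer: gates executed in parallel, on pairwise disjoint sets of qubits. -/
structure Layer (Q : Type) [DecidableEq Q] : Type where
  gates : List (Gate Q)
  disjoint : gates.Pairwise fun g g' => Disjoint g.qubits g'.qubits

def Layer.op (L : Layer Q) : Op Q := (L.gates.map Gate.op).prod

/-- A circuit is a sequence of layers; the head of the list is executed first. -/
abbrev Circuit (Q : Type) [DecidableEq Q] : Type := List (Layer Q)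

/-- The depth of a circuit is its number of layers. -/
def Circuit.depth (C : Circuit Q) : ℕ := List.length C

/-- The unitary implemented by a circuit. -/
def Circuit.op (C : Circuit Q) : Op Q := (C.map Layer.op).reverse.prod

end Circuits

/-! ### The fermionic operators under the Jordan–Wigner encoding -/

/-- The qubits of `N` sites with `ν + 1` modes each; mode `0` is physical, `1, …, ν` are auxiliary.
The Jordan–Wigner order is lexicographic. Sites are numbered from `0`. -/
abbrev SysQ (N ν : ℕ) : Type := Fin N × Fin (ν + 1)

section Fermions

variable {N ν : ℕ}

/-- `S_i = ∏_{j < i} ∏_{k = 0}^{ν} Z_j^{(k)}` -/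
def strS (i : Fin N) : Op (SysQ N ν) := zString (Finset.univ.filter fun q => q.1 < i)

/-- `Z_{i,<ℓ} = ∏_{m < ℓ} Z_i^{(m)}` -/
def strZlt (i : Fin N) (l : Fin (ν + 1)) : Op (SysQ N ν) :=
  zString (Finset.univ.filter fun q => q.1 = i ∧ q.2 < l)

/-- `Z_{i,≤ν} = ∏_{m = 0}^{ν} Z_i^{(m)}` -/
def strZall (i : Fin N) : Op (SysQ N ν) := zString (Finset.univ.filter fun q => q.1 = i)

/-- The fermionic mode `b_i^{(ℓ)} = S_i Z_{i,<ℓ} (X_i^{(ℓ)} - i Y_i^{(ℓ)}) / 2`. -/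
def modeB (l : Fin (ν + 1)) (i : Fin N) : Op (SysQ N ν) :=
  strS i * strZlt i l *
    ((2 : ℂ)⁻¹ • (onQubit matX (i, l) - Complex.I • onQubit matY (i, l)))

/-- The Majorana operator `c_i^{(ℓ)} = b + b†`. -/
def majC (l : Fin (ν + 1)) (i : Fin N) : Op (SysQ N ν) := modeB l i + (modeB l i)ᴴ

/-- The Majorana operator `d_i^{(ℓ)} = -i (b - b†)`. -/
def majD (l : Fin (ν + 1)) (i : Fin N) : Op (SysQ N ν) :=
  (-Complex.I) • (modeB l i - (modeB l i)ᴴ)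

/-- The stabilizer `P_{ij}^{(ℓ)} = i c_i^{(ℓ)} d_j^{(ℓ)}`. -/
def stab (l : Fin (ν + 1)) (i j : Fin N) : Op (SysQ N ν) := Complex.I • (majC l i * majD l j)

end Fermions

/-! ### The ordered operator; `N = 2 n` sites, grouped in `n` consecutive pairs -/

section Ordered

variable {n ν : ℕ}

/-- First site of the `k`-th pair (site `2k-1` if both are counted from `1`). -/
def fstSite (k : Fin n) : Fin (2 * n) := ⟨2 * k, by omega⟩

/-- Second site of the `k`-th pair (site `2k` if both are counted from `1`). -/
def sndSite (k : Fin n) : Fin (2 * n) := ⟨2 * k + 1, by omega⟩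

/-- The `2 (ν + 1)` qubits of the `k`-th pair of sites. -/
def pairQubits (ν : ℕ) (k : Fin n) : Finset (SysQ (2 * n) ν) :=
  Finset.univ.filter fun q => q.1 = fstSite k ∨ q.1 = sndSite k

/-- `C_ord^{(ℓ)} = 2^{-N/4} (c_1 - i d_2)(c_3 - i d_4) ⋯ (c_{N-1} - i d_N)`, `N = 2 n`. -/
def cOrd (l : Fin (ν + 1)) : Op (SysQ (2 * n) ν) :=
  (((2 : ℝ) ^ (((2 * n : ℕ) : ℝ) / 4) : ℝ) : ℂ)⁻¹ •
    (List.ofFn fun k : Fin n => majC l (fstSite k) - Complex.I • majD l (sndSite k)).prod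

/-- `(Z_{2k-1,≤ν} Z_{2k,≤ν})^{N/2-k}` (`k` counted from `1`; here `k` is counted from `0`). -/
def residualZ (ν : ℕ) (k : Fin n) : Op (SysQ (2 * n) ν) :=
  (strZall (fstSite k) * strZall (sndSite k)) ^ (n - (k + 1))

/-- `c̃_{2k-1} = Z_{2k-1,<ℓ} X_{2k-1}^{(ℓ)} (Z_{2k-1,≤ν} Z_{2k,≤ν})^{N/2-k}` -/
def localC (l : Fin (ν + 1)) (k : Fin n) : Op (SysQ (2 * n) ν) :=
  strZlt (fstSite k) l * onQubit matX (fstSite k, l) * residualZ ν k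

/-- `d̃_{2k} = - Z_{2k-1,≤ν} Z_{2k,<ℓ} Y_{2k}^{(ℓ)} (Z_{2k-1,≤ν} Z_{2k,≤ν})^{N/2-k}` -/
def localD (l : Fin (ν + 1)) (k : Fin n) : Op (SysQ (2 * n) ν) :=
  -(strZall (fstSite k) * strZlt (sndSite k) l * onQubit matY (sndSite k, l) * residualZ ν k)

/-- The system qubits together with `n = N/2` ancilla qubits. -/
abbrev TotQ (n ν : ℕ) : Type := SysQ (2 * n) ν ⊕ Fin n

/-- A system operator tensored with the identity on the ancillas. -/
def sysOp (A : Op (SysQ (2 * n) ν)) : Op (TotQ n ν) :=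
  Matrix.of fun x y =>
    if ∀ k, x (Sum.inr k) = y (Sum.inr k) then A (x ∘ Sum.inl) (y ∘ Sum.inl) else 0

/-- `Ũ_k = |0⟩⟨0|_{anc,k} c̃_{2k-1} + |1⟩⟨1|_{anc,k} (-i d̃_{2k})` -/
def uLocal (l : Fin (ν + 1)) (k : Fin n) : Op (TotQ n ν) :=
  onQubit proj0 (Sum.inr k) * sysOp (localC l k) +
    onQubit proj1 (Sum.inr k) * sysOp ((-Complex.I) • localD l k)

/-- The qubits of the `k`-th pair of sites and the `k`-th ancilla. -/
def blockQubits (ν : ℕ) (k : Fin n) : Finset (TotQ n ν) :=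
  (pairQubits ν k).disjSum {k}

/-- `U_ord = ∏_k Ũ_k` -/
def uOrd (l : Fin (ν + 1)) : Op (TotQ n ν) := (List.ofFn fun k : Fin n => uLocal l k).prod

/-- A Hadamard on every ancilla. -/
def hadAnc (n ν : ℕ) : Op (TotQ n ν) :=
  (List.ofFn fun k : Fin n => onQubit matH (Sum.inr k : TotQ n ν)).prod

/-- The preparation unitary `H_anc U_ord H_anc`. -/
def uPrep (l : Fin (ν + 1)) : Op (TotQ n ν) := hadAnc n ν * uOrd l * hadAnc n ν

/-- `|0…0⟩_anc ⊗ ψ` -/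
def withZeroAnc (ψ : Ket (SysQ (2 * n) ν)) : Ket (TotQ n ν) :=
  fun x => if ∀ k, x (Sum.inr k) = 0 then ψ (x ∘ Sum.inl) else 0

/-- The unnormalized state of the system after the ancillas of `Φ` have been measured in the
computational basis with outcome `m`, i.e. `⟨m|_anc Φ`. -/
def afterOutcome (Φ : Ket (TotQ n ν)) (m : Fin n → Fin 2) : Ket (SysQ (2 * n) ν) :=
  fun s => Φ (Sum.elim s m)

/-- `∏_k (c_{2k-1} - (-1)^{m_k} i d_{2k})` -/
def signedProd (l : Fin (ν + 1)) (m : Fin n → Fin 2) : Op (SysQ (2 * n) ν) :=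
  (List.ofFn fun k : Fin n =>
    majC l (fstSite k) - ((-1 : ℂ) ^ (m k : ℕ) * Complex.I) • majD l (sndSite k)).prod

end Ordered

end OrderedPrep

end

open OrderedPrep

namespace OrderedPrep

/-! ### Entries of single-qubit operators. -/

section Register

variable {Q : Type} [Fintype Q] [DecidableEq Q]

/-! Both Majorana operators of the pair `k` carry the same Jordan–Wigner string, the product of the
full `Z` strings of the earlier pairs. These pair strings commute with each other and with the
remaining factors of every other pair. Each can therefore be moved to its own pair, where it appears
once for every later pair, that is `n - (k + 1)` times with `k` counted from zero. This is
`prod_ofFn_string`; applied to factors with arbitrary signs it gives `signedProd_eq`, a product of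
commuting operators on disjoint pairs.

After removal of the string the two operators `bareC` and `bareD` of a pair square to one and
anticommute. Hence the signed stabilizer exchanges the two terms of the factor of its own pair
(`smul_stab_mul_local`) and commutes with all other factors.

The Hadamards on the ancillas distribute over the blocks. Since `H|0⟩⟨0|H` and `H|1⟩⟨1|H` are `(1 ±
X)/2`, each conjugated block is half of the sum of its two branches plus half of an ancilla flip
times their difference (`matH_conj_uLocal`). Starting from zero, each measured bit selects one of
the two terms, which gives `afterOutcome_uPrep`.

For the depth, a block is a product of two controlled Pauli strings and an uncontrolled `Z` string.
A balanced tree of `CNOT` gates collects the parity of a string in one qubit, so that one `CZ`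
controls the whole string at logarithmic depth (`exists_parity_circuit`, `Impl.ctrl_zString`).
Blocks occupy disjoint qubits and run in parallel (`Impl.par_list`), so the depth does not depend on
`n`. -/

theorem sum_ite_agree_off {M : Type*} [AddCommMonoid M] (q : Q) (x : Basis Q) (f : Basis Q → M) :
    (∑ z, if ∀ r, r ≠ q → x r = z r then f z else 0) = ∑ b, f (Function.update x q b) := by
  rw [← Finset.sum_filter]
  refine Finset.sum_bij' (fun z _ => z q) (fun b _ => Function.update x q b) ?_ ?_ ?_ ?_ ?_
  · simp
  · intro b _
    simp +contextual [Function.update_of_ne]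
  · intro z hz
    simp only [Finset.mem_filter, Finset.mem_univ, true_and] at hz
    funext r
    by_cases h : r = q
    · subst h; simp
    · simp [Function.update_of_ne h, hz r h]
  · simp
  · intro z hz
    simp only [Finset.mem_filter, Finset.mem_univ, true_and] at hz
    congr 1
    funext r
    by_cases h : r = q
    · subst h; simp
    · simp [Function.update_of_ne h, hz r h]

theorem onQubit_mulVec_apply (A : Matrix (Fin 2) (Fin 2) ℂ) (q : Q) (v : Ket Q) (x : Basis Q) :
    (onQubit A q *ᵥ v) x = ∑ b, A (x q) b * v (Function.update x q b) := by
  have h := sum_ite_agree_off q x (fun z => A (x q) (z q) * v z)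
  simp only [Function.update_self] at h
  rw [← h]
  simp [Matrix.mulVec, dotProduct, onQubit, ite_mul]

theorem onQubit_mul_apply (A : Matrix (Fin 2) (Fin 2) ℂ) (q : Q) (M : Op Q) (x y : Basis Q) :
    (onQubit A q * M) x y = ∑ b, A (x q) b * M (Function.update x q b) y := by
  have h := sum_ite_agree_off q x (fun z => A (x q) (z q) * M z y)
  simp only [Function.update_self] at h
  rw [← h]
  simp [Matrix.mul_apply, onQubit, ite_mul]

theorem mul_onQubit_apply (A : Matrix (Fin 2) (Fin 2) ℂ) (q : Q) (M : Op Q) (x y : Basis Q) :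
    (M * onQubit A q) x y = ∑ b, M x (Function.update y q b) * A b (y q) := by
  have h := sum_ite_agree_off q y (fun z => M x z * A (z q) (y q))
  simp only [Function.update_self] at h
  rw [← h]
  simp [Matrix.mul_apply, onQubit, mul_ite, eq_comm]

theorem onQubit_mul (A B : Matrix (Fin 2) (Fin 2) ℂ) (q : Q) :
    onQubit (A * B) q = onQubit A q * onQubit B q := by
  ext x y
  rw [onQubit_mul_apply]
  have h : ∀ b : Fin 2, (∀ r, r ≠ q → Function.update x q b r = y r) ↔ ∀ r, r ≠ q → x r = y r := by
    intro b
    refine forall_congr' fun r => imp_congr_right fun hr => ?_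
    rw [Function.update_of_ne hr]
  simp only [onQubit, Matrix.of_apply, h, Function.update_self, Matrix.mul_apply]
  split_ifs <;> simp

theorem onQubit_one (q : Q) : onQubit 1 q = (1 : Op Q) := by
  ext x y
  simp only [onQubit, Matrix.of_apply, Matrix.one_apply]
  by_cases h : x = y
  · simp [h]
  · rw [if_neg h]
    split_ifs with h1 h2
    · exact absurd (funext fun r => if hr : r = q then hr ▸ h2 else h1 r hr) h
    · rfl
    · rfl

theorem onQubit_add (A B : Matrix (Fin 2) (Fin 2) ℂ) (q : Q) :
    onQubit (A + B) q = onQubit A q + onQubit B q := by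
  ext x y
  simp only [onQubit, Matrix.of_apply, Matrix.add_apply]
  split_ifs <;> simp

theorem onQubit_smul (a : ℂ) (A : Matrix (Fin 2) (Fin 2) ℂ) (q : Q) :
    onQubit (a • A) q = a • onQubit A q := by
  ext x y
  simp only [onQubit, Matrix.of_apply, Matrix.smul_apply]
  split_ifs <;> simp

theorem onQubit_zero (q : Q) : onQubit 0 q = (0 : Op Q) := by
  ext x y
  simp [onQubit]

theorem onQubit_conjTranspose (A : Matrix (Fin 2) (Fin 2) ℂ) (q : Q) :
    (onQubit A q)ᴴ = onQubit Aᴴ q := by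
  ext x y
  simp only [onQubit, Matrix.of_apply, Matrix.conjTranspose_apply, apply_ite star, star_zero,
    eq_comm]

theorem onQubit_matX_mul_apply (q : Q) (M : Op Q) (x y : Basis Q) :
    (onQubit matX q * M) x y = M (Function.update x q (1 - x q)) y := by
  rw [onQubit_mul_apply, Fin.sum_univ_two]
  generalize x q = b
  fin_cases b <;> simp [matX]

theorem mul_onQubit_matX_apply (q : Q) (M : Op Q) (x y : Basis Q) :
    (M * onQubit matX q) x y = M x (Function.update y q (1 - y q)) := by
  rw [mul_onQubit_apply, Fin.sum_univ_two]
  generalize y q = b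
  fin_cases b <;> simp [matX]

theorem onQubit_matZ_eq_diagonal (q : Q) :
    onQubit matZ q = Matrix.diagonal fun x : Basis Q => (-1 : ℂ) ^ (x q : ℕ) := by
  ext x y
  simp only [onQubit, Matrix.of_apply, Matrix.diagonal_apply]
  by_cases h : x = y
  · subst h
    simp only [implies_true, if_true]
    generalize x q = b
    fin_cases b <;> simp [matZ]
  · rw [if_neg h]
    split_ifs with h1
    · have h2 : x q ≠ y q := fun h2 =>
        h (funext fun r => if hr : r = q then hr ▸ h2 else h1 r hr)
      revert h2
      generalize x q = b
      generalize y q = c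
      fin_cases b <;> fin_cases c <;> simp [matZ]
    · rfl

/-! ### Supports -/

/-- The entry formula is symmetric in the two operators up to the order of scalar factors, so
operators with disjoint supports commute. -/
theorem SupportedOn.mul_apply {A B : Op Q} {T T' : Finset Q} (hT : Disjoint T T')
    {a : Matrix ({q // q ∈ T} → Fin 2) ({q // q ∈ T} → Fin 2) ℂ}
    {b : Matrix ({q // q ∈ T'} → Fin 2) ({q // q ∈ T'} → Fin 2) ℂ}
    (ha : ∀ x y : Basis Q,
      A x y = if ∀ q, q ∉ T → x q = y q then a (fun q => x q) (fun q => y q) else 0)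
    (hb : ∀ x y : Basis Q,
      B x y = if ∀ q, q ∉ T' → x q = y q then b (fun q => x q) (fun q => y q) else 0)
    (x y : Basis Q) :
    (A * B) x y = if ∀ q, q ∉ T → q ∉ T' → x q = y q then
      a (fun q => x q) (fun q => y q) * b (fun q => x q) (fun q => y q) else 0 := by
  have hnot : ∀ q ∈ T', q ∉ T := fun q h h' => Finset.disjoint_left.1 hT h' h
  -- `A` can change labels only in `T` and `B` only in `T'`, so the only possible intermediate label
  -- is `y` on `T` and `x` elsewhere.
  rw [Matrix.mul_apply, Finset.sum_eq_single (T.piecewise y x)]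
  · have e1 : ∀ q, q ∉ T → x q = T.piecewise y x q := fun q hq => by
      rw [Finset.piecewise_eq_of_notMem _ _ _ hq]
    have e2 : (fun q : {q // q ∈ T} => T.piecewise y x q) = fun q : {q // q ∈ T} => y q :=
      funext fun q => Finset.piecewise_eq_of_mem _ _ _ q.2
    have e3 : (fun q : {q // q ∈ T'} => T.piecewise y x q) = fun q : {q // q ∈ T'} => x q :=
      funext fun q => Finset.piecewise_eq_of_notMem _ _ _ (hnot q q.2)
    have e4 : (∀ q, q ∉ T' → T.piecewise y x q = y q) ↔ ∀ q, q ∉ T → q ∉ T' → x q = y q := by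
      refine forall_congr' fun q => ?_
      by_cases hq : q ∈ T <;> simp [hq]
    rw [ha, hb, if_pos e1, e2, e3]
    simp only [e4, mul_ite, mul_zero]
  · intro z _ hz
    rw [ha, hb]
    split_ifs with h1 h2
    · refine absurd (funext fun q => ?_) hz
      by_cases hq : q ∈ T
      · rw [Finset.piecewise_eq_of_mem _ _ _ hq]
        exact h2 q fun h' => hnot q h' hq
      · rw [Finset.piecewise_eq_of_notMem _ _ _ hq, h1 q hq]
    all_goals simp
  · simp

theorem SupportedOn.commute {A B : Op Q} {T T' : Finset Q} (hA : SupportedOn A T)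
    (hB : SupportedOn B T') (hT : Disjoint T T') : Commute A B := by
  obtain ⟨a, ha⟩ := hA
  obtain ⟨b, hb⟩ := hB
  ext x y
  rw [SupportedOn.mul_apply hT ha hb, SupportedOn.mul_apply hT.symm hb ha, mul_comm]
  congr 1
  exact propext (forall_congr' fun q => ⟨fun h h1 h2 => h h2 h1, fun h h1 h2 => h h2 h1⟩)

theorem onQubit_supportedOn (A : Matrix (Fin 2) (Fin 2) ℂ) (q : Q) :
    SupportedOn (onQubit A q) {q} := by
  refine ⟨fun u v => A (u ⟨q, by simp⟩) (v ⟨q, by simp⟩), fun x y => ?_⟩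
  simp [onQubit]

theorem onQubit_commute (A B : Matrix (Fin 2) (Fin 2) ℂ) {q r : Q} (h : q ≠ r) :
    Commute (onQubit A q) (onQubit B r) :=
  (onQubit_supportedOn A q).commute (onQubit_supportedOn B r) (by simpa using h)

/-- Comparing entries of `A Z` and `Z A` gives opposite signs when the labels at `q` differ. -/
theorem apply_eq_zero_of_commute_matZ {A : Op Q} {q : Q} (hZ : Commute A (onQubit matZ q))
    {x y : Basis Q} (h : x q ≠ y q) : A x y = 0 := by
  have h1 : (A * onQubit matZ q) x y = (onQubit matZ q * A) x y := by rw [hZ.eq]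
  rw [onQubit_matZ_eq_diagonal, Matrix.mul_diagonal, Matrix.diagonal_mul] at h1
  revert h1 h
  generalize x q = b
  generalize y q = c
  fin_cases b <;> fin_cases c <;> simp <;> intro h <;>
    first | linear_combination h / 2 | linear_combination -h / 2

theorem apply_update_of_commute_matX {A : Op Q} {q : Q} (hX : Commute A (onQubit matX q))
    {x y : Basis Q} (h : x q = y q) (b : Fin 2) :
    A (Function.update x q b) (Function.update y q b) = A x y := by
  by_cases hb : b = x q
  · have : b = y q := hb.trans h
    conv_lhs => rw [hb, Function.update_eq_self, ← hb, this, Function.update_eq_self]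
  · have hb' : b = 1 - x q := by
      revert hb
      generalize x q = c
      fin_cases b <;> fin_cases c <;> simp
    have h1 : (A * onQubit matX q) (Function.update x q b) y =
      (onQubit matX q * A) (Function.update x q b) y := by rw [hX.eq]
    rw [mul_onQubit_matX_apply, onQubit_matX_mul_apply, ← h, ← hb'] at h1
    rw [h1, Function.update_self, Function.update_idem]
    congr 1
    rw [hb', sub_sub_cancel, Function.update_eq_self]

/-- `X` and `Z` generate all operators of a qubit, so being trivial on a qubit can be tested by
commutation with these two. In this form closure under sums, products and enlargement of the set is
immediate. -/
theorem supportedOn_iff_commute {A : Op Q} {T : Finset Q} :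
    SupportedOn A T ↔
      ∀ q, q ∉ T → Commute A (onQubit matX q) ∧ Commute A (onQubit matZ q) := by
  constructor
  · intro h q hq
    exact ⟨h.commute (onQubit_supportedOn _ q) (by simpa using hq),
      h.commute (onQubit_supportedOn _ q) (by simpa using hq)⟩
  · intro h
    refine ⟨fun u v => A (fun q => if hq : q ∈ T then u ⟨q, hq⟩ else 0)
      (fun q => if hq : q ∈ T then v ⟨q, hq⟩ else 0), fun x y => ?_⟩
    split_ifs with hxy
    -- The local matrix was defined by padding labels with zeros outside `T`. Commutation with `X`
    -- allows the common label of both arguments to be reset to zero one qubit at a time.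
    · have key : ∀ S : Finset Q, (∀ q ∈ S, q ∉ T) →
          A (S.piecewise 0 x) (S.piecewise 0 y) = A x y := by
        intro S
        induction S using Finset.induction_on with
        | empty => simp
        | insert q S hq ih =>
          intro hS
          rw [Finset.piecewise_insert, Finset.piecewise_insert, ← ih fun r hr =>
            hS r (Finset.mem_insert_of_mem hr)]
          refine apply_update_of_commute_matX (h q (hS q (by simp))).1 ?_ _
          rw [Finset.piecewise_eq_of_notMem _ _ _ hq, Finset.piecewise_eq_of_notMem _ _ _ hq]
          exact hxy q (hS q (by simp))
      rw [← key Tᶜ (by simp)]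
      congr 1 <;> funext q <;> by_cases hq : q ∈ T <;> simp [hq]
    · push Not at hxy
      obtain ⟨q, hq, hne⟩ := hxy
      exact apply_eq_zero_of_commute_matZ (h q hq).2 hne

theorem SupportedOn.mono {A : Op Q} {T T' : Finset Q} (h : SupportedOn A T) (hT : T ⊆ T') :
    SupportedOn A T' :=
  supportedOn_iff_commute.2 fun q hq => supportedOn_iff_commute.1 h q fun h' => hq (hT h')

theorem SupportedOn.mul {A B : Op Q} {T : Finset Q} (hA : SupportedOn A T)
    (hB : SupportedOn B T) : SupportedOn (A * B) T := by
  rw [supportedOn_iff_commute] at *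
  exact fun q hq => ⟨(hA q hq).1.mul_left (hB q hq).1, (hA q hq).2.mul_left (hB q hq).2⟩

theorem SupportedOn.add {A B : Op Q} {T : Finset Q} (hA : SupportedOn A T)
    (hB : SupportedOn B T) : SupportedOn (A + B) T := by
  rw [supportedOn_iff_commute] at *
  exact fun q hq => ⟨(hA q hq).1.add_left (hB q hq).1, (hA q hq).2.add_left (hB q hq).2⟩

theorem SupportedOn.smul {A : Op Q} {T : Finset Q} (a : ℂ) (hA : SupportedOn A T) :
    SupportedOn (a • A) T := by
  rw [supportedOn_iff_commute] at *
  exact fun q hq => ⟨(hA q hq).1.smul_left a, (hA q hq).2.smul_left a⟩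

theorem SupportedOn.neg {A : Op Q} {T : Finset Q} (hA : SupportedOn A T) :
    SupportedOn (-A) T := by
  rw [supportedOn_iff_commute] at *
  exact fun q hq => ⟨(hA q hq).1.neg_left, (hA q hq).2.neg_left⟩

theorem SupportedOn.sub {A B : Op Q} {T : Finset Q} (hA : SupportedOn A T)
    (hB : SupportedOn B T) : SupportedOn (A - B) T := by
  rw [sub_eq_add_neg]
  exact hA.add hB.neg

theorem supportedOn_one (T : Finset Q) : SupportedOn (1 : Op Q) T :=
  supportedOn_iff_commute.2 fun _ _ => ⟨Commute.one_left _, Commute.one_left _⟩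

theorem SupportedOn.pow {A : Op Q} {T : Finset Q} (hA : SupportedOn A T) (n : ℕ) :
    SupportedOn (A ^ n) T := by
  rw [supportedOn_iff_commute] at *
  exact fun q hq => ⟨(hA q hq).1.pow_left n, (hA q hq).2.pow_left n⟩

theorem SupportedOn.list_prod {L : List (Op Q)} {T : Finset Q} (h : ∀ A ∈ L, SupportedOn A T) :
    SupportedOn L.prod T := by
  induction L with
  | nil => exact supportedOn_one T
  | cons A L ih =>
    rw [List.prod_cons]
    exact (h A (by simp)).mul (ih fun B hB => h B (by simp [hB]))

theorem onQubit_supportedOn_of_mem (A : Matrix (Fin 2) (Fin 2) ℂ) {q : Q} {T : Finset Q}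
    (h : q ∈ T) : SupportedOn (onQubit A q) T :=
  (onQubit_supportedOn A q).mono (by simpa using h)

theorem weight_le_card {A : Op Q} {T : Finset Q} (h : SupportedOn A T) : weight A ≤ T.card := by
  rw [weight, ← Set.ncard_coe_finset]
  refine Set.ncard_le_ncard (fun q hq => ?_) T.finite_toSet
  by_contra hqT
  exact hq (h.mono fun r hr => Finset.mem_erase.2 ⟨fun e => hqT (e ▸ hr), Finset.mem_univ r⟩)

/-! ### Strings of `Z` operators -/

/-- The diagonal form removes the arbitrary enumeration `T.toList` and reduces identities of strings
to identities of finite products of signs. -/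
theorem zString_eq_diagonal (T : Finset Q) :
    zString T = Matrix.diagonal fun x : Basis Q => ∏ q ∈ T, (-1 : ℂ) ^ (x q : ℕ) := by
  have h : ∀ L : List Q, (L.map fun q => onQubit matZ q).prod =
      Matrix.diagonal fun x : Basis Q => (L.map fun q => (-1 : ℂ) ^ (x q : ℕ)).prod := by
    intro L
    induction L with
    | nil => simp
    | cons q L ih =>
      rw [List.map_cons, List.prod_cons, ih, onQubit_matZ_eq_diagonal, Matrix.diagonal_mul_diagonal]
      simp
  rw [zString, h]
  congr 1
  funext x
  exact Finset.prod_map_toList T fun q => (-1 : ℂ) ^ (x q : ℕ)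

theorem zString_supportedOn (T : Finset Q) : SupportedOn (zString T) T := by
  refine SupportedOn.list_prod fun A hA => ?_
  obtain ⟨q, hq, rfl⟩ := List.mem_map.1 hA
  exact onQubit_supportedOn_of_mem _ (Finset.mem_toList.1 hq)

theorem zString_empty : zString (∅ : Finset Q) = 1 := by simp [zString]

theorem zString_singleton (q : Q) : zString {q} = onQubit matZ q := by simp [zString]

theorem zString_union {S T : Finset Q} (h : Disjoint S T) :
    zString (S ∪ T) = zString S * zString T := by
  simp only [zString_eq_diagonal, Matrix.diagonal_mul_diagonal, Finset.prod_union h]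

theorem zString_insert {q : Q} {T : Finset Q} (h : q ∉ T) :
    zString (insert q T) = onQubit matZ q * zString T := by
  rw [Finset.insert_eq, zString_union (by simpa using h), zString_singleton]

theorem zString_mul_self (T : Finset Q) : zString T * zString T = 1 := by
  rw [zString_eq_diagonal, Matrix.diagonal_mul_diagonal, ← Matrix.diagonal_one]
  congr 1
  funext x
  rw [← Finset.prod_mul_distrib]
  refine Finset.prod_eq_one fun q _ => ?_
  rw [← pow_add, ← two_mul, pow_mul]
  simp

theorem zString_commute (S T : Finset Q) : Commute (zString S) (zString T) := by
  rw [zString_eq_diagonal, zString_eq_diagonal]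
  exact Matrix.commute_diagonal _ _

theorem zString_conjTranspose (T : Finset Q) : (zString T)ᴴ = zString T := by
  rw [zString_eq_diagonal, Matrix.diagonal_conjTranspose]
  congr 1
  funext x
  simp

theorem zString_commute_onQubit (A : Matrix (Fin 2) (Fin 2) ℂ) {q : Q} {T : Finset Q}
    (h : q ∉ T) : Commute (zString T) (onQubit A q) :=
  (zString_supportedOn T).commute (onQubit_supportedOn A q) (by simpa using h)

/-- Exactly one `Z` of the string sits on the qubit of `A`; the others commute with it. -/
theorem zString_anticommute_onQubit {A : Matrix (Fin 2) (Fin 2) ℂ} (hA : matZ * A = -(A * matZ))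
    {q : Q} {T : Finset Q} (h : q ∈ T) :
    zString T * onQubit A q = -(onQubit A q * zString T) := by
  rw [← Finset.insert_erase h, zString_insert (by simp), mul_assoc,
    (zString_commute_onQubit A (Finset.notMem_erase q T)).eq, ← mul_assoc, ← onQubit_mul, hA,
    ← neg_one_smul ℂ (A * matZ), onQubit_smul, neg_one_smul, onQubit_mul]
  simp only [neg_mul, mul_assoc]

/-! ### Unitarity -/

theorem onQubit_mem_unitary {A : Matrix (Fin 2) (Fin 2) ℂ} (hA : Aᴴ * A = 1) (q : Q) :
    onQubit A q ∈ Matrix.unitaryGroup (Basis Q) ℂ := by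
  rw [Matrix.mem_unitaryGroup_iff', Matrix.star_eq_conjTranspose, onQubit_conjTranspose,
    ← onQubit_mul, hA, onQubit_one]

theorem zString_mem_unitary (T : Finset Q) : zString T ∈ Matrix.unitaryGroup (Basis Q) ℂ := by
  rw [Matrix.mem_unitaryGroup_iff', Matrix.star_eq_conjTranspose, zString_conjTranspose,
    zString_mul_self]

theorem matX_conjTranspose : matXᴴ = matX := by
  ext i j; fin_cases i <;> fin_cases j <;> simp [matX]

theorem matY_conjTranspose : matYᴴ = matY := by
  ext i j; fin_cases i <;> fin_cases j <;> simp [matY]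

theorem matH_conjTranspose : matHᴴ = matH := by
  ext i j; fin_cases i <;> fin_cases j <;> simp [matH]

theorem proj0_conjTranspose : proj0ᴴ = proj0 := by
  ext i j; fin_cases i <;> fin_cases j <;> simp [proj0]

theorem proj1_conjTranspose : proj1ᴴ = proj1 := by
  ext i j; fin_cases i <;> fin_cases j <;> simp [proj1]

theorem matX_mul_self : matX * matX = 1 := by
  simp [matX, Matrix.one_fin_two]

theorem matY_mul_self : matY * matY = 1 := by
  simp [matY, Matrix.one_fin_two]

theorem inv_sqrt_two_mul_self :
    ((Real.sqrt 2 : ℝ) : ℂ)⁻¹ * ((Real.sqrt 2 : ℝ) : ℂ)⁻¹ = 2⁻¹ := by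
  rw [← mul_inv, ← Complex.ofReal_mul, Real.mul_self_sqrt (by norm_num)]
  simp

theorem matH_mul_self : matH * matH = 1 := by
  rw [matH, smul_mul_smul_comm, inv_sqrt_two_mul_self]
  ext i j; fin_cases i <;> fin_cases j <;> norm_num

theorem proj0_add_proj1 : proj0 + proj1 = 1 := by
  simp [proj0, proj1, Matrix.one_fin_two]

theorem proj0_mul_self : proj0 * proj0 = proj0 := by
  ext i j; fin_cases i <;> fin_cases j <;> simp [proj0]

theorem proj1_mul_self : proj1 * proj1 = proj1 := by
  ext i j; fin_cases i <;> fin_cases j <;> simp [proj1]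

theorem proj0_mul_proj1 : proj0 * proj1 = 0 := by
  ext i j; fin_cases i <;> fin_cases j <;> simp [proj0, proj1]

theorem proj1_mul_proj0 : proj1 * proj0 = 0 := by
  ext i j; fin_cases i <;> fin_cases j <;> simp [proj0, proj1]

theorem matX_mul_proj0_mul_matX : matX * proj0 * matX = proj1 := by
  ext i j; fin_cases i <;> fin_cases j <;> simp [proj0, proj1, matX]

theorem matX_mul_proj1_mul_matX : matX * proj1 * matX = proj0 := by
  ext i j; fin_cases i <;> fin_cases j <;> simp [proj0, proj1, matX]

theorem matH_mul_matX_mul_matH : matH * matX * matH = matZ := by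
  rw [matH, smul_mul_assoc, smul_mul_smul_comm, inv_sqrt_two_mul_self]
  ext i j; fin_cases i <;> fin_cases j <;> norm_num [matX, matZ]

theorem matH_mul_proj0_mul_matH : matH * proj0 * matH = (2⁻¹ : ℂ) • (1 + matX) := by
  rw [matH, smul_mul_assoc, smul_mul_smul_comm, inv_sqrt_two_mul_self]
  ext i j; fin_cases i <;> fin_cases j <;> norm_num [matX, proj0]

theorem matH_mul_proj1_mul_matH : matH * proj1 * matH = (2⁻¹ : ℂ) • (1 - matX) := by
  rw [matH, smul_mul_assoc, smul_mul_smul_comm, inv_sqrt_two_mul_self]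
  ext i j; fin_cases i <;> fin_cases j <;> norm_num [matX, proj1]

theorem I_smul_matY : Complex.I • matY = matZ * matX := by
  ext i j; fin_cases i <;> fin_cases j <;> simp [matX, matY, matZ]

theorem matZ_mul_matX : matZ * matX = -(matX * matZ) := by
  ext i j; fin_cases i <;> fin_cases j <;> simp [matX, matZ]

end Register

/-! ### Sequential and parallel composition of circuits. -/

section Circuits

variable {Q : Type} [Fintype Q] [DecidableEq Q]

theorem Gate.op_supportedOn (g : Gate Q) : SupportedOn g.op g.qubits := by
  cases g with
  | had q => exact onQubit_supportedOn _ q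
  | x q => exact onQubit_supportedOn _ q
  | cx c t h =>
    exact (onQubit_supportedOn_of_mem _ (by simp [Gate.qubits])).add
      ((onQubit_supportedOn_of_mem _ (by simp [Gate.qubits])).mul
        (onQubit_supportedOn_of_mem _ (by simp [Gate.qubits])))
  | cz c t h =>
    exact (onQubit_supportedOn_of_mem _ (by simp [Gate.qubits])).add
      ((onQubit_supportedOn_of_mem _ (by simp [Gate.qubits])).mul
        (onQubit_supportedOn_of_mem _ (by simp [Gate.qubits])))

/-- Every gate of the circuit touches only qubits of `T`. -/
def Circuit.Within (C : Circuit Q) (T : Finset Q) : Prop :=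
  ∀ L ∈ C, ∀ g ∈ L.gates, g.qubits ⊆ T

theorem Layer.op_supportedOn {L : Layer Q} {T : Finset Q} (h : ∀ g ∈ L.gates, g.qubits ⊆ T) :
    SupportedOn L.op T := by
  refine SupportedOn.list_prod fun A hA => ?_
  obtain ⟨g, hg, rfl⟩ := List.mem_map.1 hA
  exact g.op_supportedOn.mono (h g hg)

theorem Circuit.op_supportedOn {C : Circuit Q} {T : Finset Q} (h : C.Within T) :
    SupportedOn C.op T := by
  refine SupportedOn.list_prod fun A hA => ?_
  obtain ⟨L, hL, rfl⟩ := List.mem_map.1 (List.mem_reverse.1 hA)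
  exact L.op_supportedOn (h L hL)

theorem Circuit.op_nil : Circuit.op ([] : Circuit Q) = 1 := by simp [Circuit.op]

theorem Circuit.op_cons (L : Layer Q) (C : Circuit Q) :
    Circuit.op (L :: C) = Circuit.op C * L.op := by simp [Circuit.op]

theorem Circuit.op_append (C C' : Circuit Q) :
    Circuit.op (C ++ C') = Circuit.op C' * Circuit.op C := by simp [Circuit.op]

/-- The layer without gates. -/
def Layer.idle (Q : Type) [DecidableEq Q] : Layer Q := ⟨[], List.Pairwise.nil⟩

theorem Layer.idle_op : (Layer.idle Q).op = 1 := by simp [Layer.idle, Layer.op]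

/-- Two layers on disjoint sets of qubits, executed simultaneously. -/
def Layer.par {T T' : Finset Q} (hT : Disjoint T T') (L L' : Layer Q)
    (h : ∀ g ∈ L.gates, g.qubits ⊆ T) (h' : ∀ g ∈ L'.gates, g.qubits ⊆ T') : Layer Q :=
  ⟨L.gates ++ L'.gates, List.pairwise_append.2 ⟨L.disjoint, L'.disjoint, fun g hg g' hg' =>
    Finset.disjoint_of_subset_left (h g hg) (Finset.disjoint_of_subset_right (h' g' hg') hT)⟩⟩

/-- `A` is implemented by a circuit of depth `D` whose gates touch only qubits of `T`. -/
def Impl (D : ℕ) (T : Finset Q) (A : Op Q) : Prop :=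
  ∃ C : Circuit Q, C.op = A ∧ C.depth = D ∧ C.Within T

theorem Impl.supportedOn {D : ℕ} {T : Finset Q} {A : Op Q} (h : Impl D T A) :
    SupportedOn A T := by
  obtain ⟨C, rfl, _, hC⟩ := h
  exact Circuit.op_supportedOn hC

theorem Impl.mono_right {D : ℕ} {T T' : Finset Q} {A : Op Q} (h : Impl D T A) (hT : T ⊆ T') :
    Impl D T' A := by
  obtain ⟨C, h1, h2, hC⟩ := h
  exact ⟨C, h1, h2, fun L hL g hg => (hC L hL g hg).trans hT⟩

/-- Idle layers pad a circuit to any larger depth. `Impl` can thus demand the exact depth, which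
parallel composition needs, and still give upper bounds. -/
theorem Impl.one (D : ℕ) (T : Finset Q) : Impl D T 1 := by
  refine ⟨List.replicate D (Layer.idle Q), ?_, by simp [Circuit.depth], fun L hL g hg => ?_⟩
  · simp [Circuit.op, Layer.idle_op]
  · rw [List.eq_of_mem_replicate hL] at hg
    simp [Layer.idle] at hg

theorem Impl.seq {D D' : ℕ} {T : Finset Q} {A B : Op Q} (hA : Impl D T A) (hB : Impl D' T B) :
    Impl (D + D') T (A * B) := by
  obtain ⟨C, rfl, rfl, hC⟩ := hA
  obtain ⟨C', rfl, rfl, hC'⟩ := hB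
  refine ⟨C' ++ C, Circuit.op_append _ _, by simp [Circuit.depth, add_comm], fun L hL => ?_⟩
  rcases List.mem_append.1 hL with h | h
  · exact hC' L h
  · exact hC L h

theorem Impl.mono_left {D D' : ℕ} {T : Finset Q} {A : Op Q} (h : Impl D T A) (hD : D ≤ D') :
    Impl D' T A := by
  obtain ⟨e, rfl⟩ := Nat.exists_eq_add_of_le hD
  simpa using h.seq (Impl.one e T)

theorem Impl.gate (g : Gate Q) : Impl 1 g.qubits g.op := by
  refine ⟨[⟨[g], by simp⟩], by simp [Circuit.op, Layer.op], rfl, fun L hL g' hg' => ?_⟩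
  rw [List.mem_singleton.1 hL] at hg'
  rw [List.mem_singleton.1 hg']

theorem Impl.par {D : ℕ} {T T' : Finset Q} {A B : Op Q} (hA : Impl D T A) (hB : Impl D T' B)
    (hT : Disjoint T T') : Impl D (T ∪ T') (A * B) := by
  induction D generalizing A B with
  | zero =>
    obtain ⟨C, rfl, h, -⟩ := hA
    obtain ⟨C', rfl, h', -⟩ := hB
    rw [List.eq_nil_of_length_eq_zero h, List.eq_nil_of_length_eq_zero h', Circuit.op_nil, one_mul]
    exact Impl.one 0 _
  | succ D ih =>
    obtain ⟨C, rfl, h, hC⟩ := hA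
    obtain ⟨C', rfl, h', hC'⟩ := hB
    obtain ⟨L, C, rfl⟩ := List.exists_cons_of_length_eq_add_one h
    obtain ⟨L', C', rfl⟩ := List.exists_cons_of_length_eq_add_one h'
    have hL := hC L (by simp)
    have hL' := hC' L' (by simp)
    have hC₁ : Circuit.Within C T := fun M hM => hC M (by simp [hM])
    have hC₁' : Circuit.Within C' T' := fun M hM => hC' M (by simp [hM])
    obtain ⟨C₂, e, hd, hw⟩ := ih ⟨C, rfl, by simpa [Circuit.depth] using h, hC₁⟩
      ⟨C', rfl, by simpa [Circuit.depth] using h', hC₁'⟩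
    refine ⟨Layer.par hT L L' hL hL' :: C₂, ?_, by simpa [Circuit.depth] using hd, ?_⟩
    -- The circuits are merged layer by layer; the first layer of one must pass the later layers of
    -- the other.
    · have hcomm : Commute L.op (Circuit.op C') :=
        (Layer.op_supportedOn hL).commute (Circuit.op_supportedOn hC₁') hT
      rw [Circuit.op_cons, Circuit.op_cons, Circuit.op_cons, e]
      have : (Layer.par hT L L' hL hL').op = L.op * L'.op := by simp [Layer.op, Layer.par]
      rw [this, mul_assoc, ← mul_assoc (Circuit.op C'), ← hcomm.eq]
      simp only [mul_assoc]
    · intro M hM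
      rcases List.mem_cons.1 hM with rfl | hM
      · intro g hg
        rcases List.mem_append.1 hg with hg | hg
        · exact (hL g hg).trans Finset.subset_union_left
        · exact (hL' g hg).trans Finset.subset_union_right
      · exact hw M hM

theorem Impl.par_list {ι : Type*} [DecidableEq ι] {D : ℕ} {T : ι → Finset Q} {A : ι → Op Q}
    (hA : ∀ i, Impl D (T i) (A i)) (hT : ∀ i j, i ≠ j → Disjoint (T i) (T j)) {L : List ι}
    (hL : L.Nodup) : Impl D (L.toFinset.biUnion T) (L.map A).prod := by
  induction L with
  | nil => simpa using Impl.one D _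
  | cons i L ih =>
    rw [List.nodup_cons] at hL
    rw [List.toFinset_cons, Finset.biUnion_insert, List.map_cons, List.prod_cons]
    refine (hA i).par (ih hL.2) ((Finset.disjoint_biUnion_right _ _ _).2 fun j hj => hT i j ?_)
    rintro rfl
    exact hL.1 (List.mem_toFinset.1 hj)

/-! ### Controlled operators -/

/-- `|0⟩⟨0|_a + |1⟩⟨1|_a G`, for `G` not acting on `a`. -/
def ctrl (a : Q) (G : Op Q) : Op Q := onQubit proj0 a + onQubit proj1 a * G

theorem proj0_add_proj1_onQubit (a : Q) : onQubit proj0 a + onQubit proj1 a = 1 := by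
  rw [← onQubit_add, proj0_add_proj1, onQubit_one]

theorem ctrl_one (a : Q) : ctrl a 1 = 1 := by
  rw [ctrl, mul_one, proj0_add_proj1_onQubit]

theorem SupportedOn.commute_onQubit {G : Op Q} {T : Finset Q} (h : SupportedOn G T) {a : Q}
    (ha : a ∉ T) (A : Matrix (Fin 2) (Fin 2) ℂ) : Commute (onQubit A a) G :=
  ((onQubit_supportedOn A a).commute h (by simpa using ha))

/-- The two control projections are orthogonal, so the branches multiply separately. This lets the
`Z` string and the `X` of a Pauli string be controlled one after the other. -/
theorem ctrl_mul {a : Q} {G G' : Op Q} (hG : Commute (onQubit proj0 a) G)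
    (hG' : Commute (onQubit proj1 a) G) :
    ctrl a (G * G') = ctrl a G * ctrl a G' := by
  have h00 : onQubit proj0 a * onQubit proj0 a = onQubit proj0 a := by
    rw [← onQubit_mul, proj0_mul_self]
  have h11 : onQubit proj1 a * onQubit proj1 a = onQubit proj1 a := by
    rw [← onQubit_mul, proj1_mul_self]
  have h01 : onQubit proj0 a * onQubit proj1 a = 0 := by
    rw [← onQubit_mul, proj0_mul_proj1, onQubit_zero]
  have h10 : onQubit proj1 a * onQubit proj0 a = 0 := by
    rw [← onQubit_mul, proj1_mul_proj0, onQubit_zero]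
  simp only [ctrl, mul_add, add_mul]
  rw [h00, mul_assoc, ← hG.eq, ← mul_assoc (onQubit proj1 a) (onQubit proj0 a), h10,
    ← mul_assoc (onQubit proj0 a) (onQubit proj1 a), h01, mul_assoc, ← mul_assoc G, ← hG'.eq,
    mul_assoc, ← mul_assoc (onQubit proj1 a) (onQubit proj1 a), h11]
  simp

/-- Conjugation with operators not acting on the control. -/
theorem mul_ctrl_mul {a : Q} {E E' G : Op Q} (h : E' * E = 1)
    (h0 : Commute (onQubit proj0 a) E') (h1 : Commute (onQubit proj1 a) E') :
    E' * ctrl a G * E = ctrl a (E' * G * E) := by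
  rw [ctrl, ctrl, mul_add, add_mul, ← h0.eq, mul_assoc, h, mul_one, ← mul_assoc, ← h1.eq]
  simp only [mul_assoc]

theorem controlled_matX_mul_self {c t : Q} (h : c ≠ t) :
    controlled matX c t * controlled matX c t = 1 := by
  have := ctrl_mul (G' := onQubit matX t) (onQubit_commute proj0 matX h)
    (onQubit_commute proj1 matX h)
  rw [← onQubit_mul, matX_mul_self, onQubit_one, ctrl_one] at this
  exact this.symm

/-- A `CNOT` propagates `Z` from its target to its control; this is the single step of the parity
tree. -/
theorem controlled_matX_conj_matZ {c t : Q} (h : c ≠ t) :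
    controlled matX c t * onQubit matZ t * controlled matX c t =
      onQubit matZ t * onQubit matZ c := by
  have hz : controlled matX c t * onQubit matZ t =
      onQubit matZ t * (onQubit matZ c * controlled matX c t) := by
    have h0 := (onQubit_commute proj0 matZ h).eq
    have h1 := (onQubit_commute proj1 matZ h).eq
    have e : onQubit matX t * onQubit matZ t = -(onQubit matZ t * onQubit matX t) := by
      rw [← onQubit_mul, ← onQubit_mul, matZ_mul_matX, ← neg_one_smul ℂ (matX * matZ),
        onQubit_smul, neg_one_smul, neg_neg]
    have z0 : onQubit matZ c * onQubit proj0 c = onQubit proj0 c := by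
      rw [← onQubit_mul]; congr 1
      ext i j; fin_cases i <;> fin_cases j <;> simp [matZ, proj0]
    have z1 : onQubit matZ c * onQubit proj1 c = -onQubit proj1 c := by
      rw [← onQubit_mul, ← neg_one_smul ℂ (onQubit proj1 c), ← onQubit_smul]; congr 1
      ext i j; fin_cases i <;> fin_cases j <;> simp [matZ, proj1]
    rw [controlled, add_mul, mul_assoc, e, mul_add, ← mul_assoc (onQubit matZ c), z0, z1, h0,
      mul_neg, ← mul_assoc, h1, mul_add]
    simp only [neg_mul, mul_neg, mul_assoc]
  rw [hz, mul_assoc, mul_assoc, controlled_matX_mul_self h, mul_one]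

/-- A tree of `CNOT` gates collects the parity of `T` in the qubit `t`. -/
theorem exists_parity_circuit (d : ℕ) : ∀ (T : Finset Q) (t : Q), t ∈ T → T.card ≤ 2 ^ d →
    ∃ E E' : Op Q, Impl d T E ∧ Impl d T E' ∧ E' * E = 1 ∧
      E' * onQubit matZ t * E = zString T := by
  induction d with
  | zero =>
    intro T t ht hT
    have : T = {t} := Finset.eq_singleton_iff_unique_mem.2
      ⟨ht, fun s hs => Finset.card_le_one.1 (by simpa using hT) s hs t ht⟩
    subst this
    exact ⟨1, 1, Impl.one _ _, Impl.one _ _, by simp, by simp [zString_singleton]⟩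
  | succ d ih =>
    intro T t ht hT
    by_cases hd : T.card ≤ 2 ^ d
    · obtain ⟨E, E', h1, h2, h3, h4⟩ := ih T t ht hd
      exact ⟨E, E', h1.mono_left (by simp), h2.mono_left (by simp), h3, h4⟩
    push Not at hd
    -- `S` has exactly `2 ^ d` elements and contains the root `t`. The complement is nonempty and no
    -- larger, so both halves have parity trees of depth `d` that run in parallel.
    obtain ⟨S, hS1, hS2, hS3⟩ := Finset.exists_subsuperset_card_eq
      (Finset.singleton_subset_iff.2 ht) (by simpa using Nat.one_le_two_pow) hd.le
    have htS : t ∈ S := hS1 (by simp)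
    have hR : (T \ S).card ≤ 2 ^ d := by
      rw [Finset.card_sdiff_of_subset hS2, hS3]
      rw [pow_succ] at hT
      omega
    obtain ⟨s, hs⟩ : (T \ S).Nonempty := by
      rw [← Finset.card_pos, Finset.card_sdiff_of_subset hS2, hS3]
      omega
    obtain ⟨E₁, E₁', a1, a2, a3, a4⟩ := ih S t htS hS3.le
    obtain ⟨E₂, E₂', b1, b2, b3, b4⟩ := ih (T \ S) s hs hR
    have hdis : Disjoint S (T \ S) := Finset.disjoint_sdiff
    have hU : S ∪ (T \ S) = T := Finset.union_sdiff_of_subset hS2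
    have hst : s ≠ t := by
      rintro rfl
      exact (Finset.mem_sdiff.1 hs).2 htS
    have hg : Impl 1 T (controlled matX s t) := by
      refine (Impl.gate (Gate.cx s t hst)).mono_right ?_
      intro r hr
      simp only [Gate.qubits, Finset.mem_insert, Finset.mem_singleton] at hr
      rcases hr with rfl | rfl
      · exact (Finset.mem_sdiff.1 hs).1
      · exact ht
    have c1 : Impl d T (E₁ * E₂) := hU ▸ a1.par b1 hdis
    have c2 : Impl d T (E₁' * E₂') := hU ▸ a2.par b2 hdis
    have k12 : Commute E₁ E₂' := a1.supportedOn.commute b2.supportedOn hdis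
    have kz : Commute (onQubit matZ t) E₂' :=
      (onQubit_supportedOn_of_mem matZ htS).commute b2.supportedOn hdis
    have kz' : Commute E₁ (onQubit matZ s) :=
      a1.supportedOn.commute (onQubit_supportedOn_of_mem matZ hs) hdis
    -- One more `CNOT` joins the roots. Conjugation by it turns `Z` at `t` into `Z` at both roots,
    -- and each subtree then expands its own `Z` to the string of its half.
    refine ⟨controlled matX s t * (E₁ * E₂), E₁' * E₂' * controlled matX s t,
      add_comm 1 d ▸ hg.seq c1, c2.seq hg, ?_, ?_⟩
    · calc E₁' * E₂' * controlled matX s t * (controlled matX s t * (E₁ * E₂))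
          = E₁' * E₂' * (controlled matX s t * controlled matX s t) * (E₁ * E₂) := by
            simp only [mul_assoc]
        _ = E₁' * (E₂' * E₁) * E₂ := by
            rw [controlled_matX_mul_self hst, mul_one]; simp only [mul_assoc]
        _ = (E₁' * E₁) * (E₂' * E₂) := by rw [← k12.eq]; simp only [mul_assoc]
        _ = 1 := by rw [a3, b3, one_mul]
    · calc E₁' * E₂' * controlled matX s t * onQubit matZ t * (controlled matX s t * (E₁ * E₂))
          = E₁' * E₂' * (controlled matX s t * onQubit matZ t * controlled matX s t) *
              (E₁ * E₂) := by simp only [mul_assoc]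
        _ = E₁' * (E₂' * onQubit matZ t) * (onQubit matZ s * E₁) * E₂ := by
            rw [controlled_matX_conj_matZ hst]; simp only [mul_assoc]
        _ = E₁' * onQubit matZ t * (E₂' * E₁) * onQubit matZ s * E₂ := by
            rw [← kz.eq, ← kz'.eq]; simp only [mul_assoc]
        _ = (E₁' * onQubit matZ t * E₁) * (E₂' * onQubit matZ s * E₂) := by
            rw [← k12.eq]; simp only [mul_assoc]
        _ = zString T := by rw [a4, b4, ← zString_union hdis, hU]

/-- A `Z` string is controlled by one qubit in logarithmic depth. -/
theorem Impl.ctrl_zString {d : ℕ} {T : Finset Q} {a : Q} (ha : a ∉ T) (hT : T.card ≤ 2 ^ d) :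
    Impl (2 * d + 1) (insert a T) (ctrl a (zString T)) := by
  rcases T.eq_empty_or_nonempty with rfl | ⟨t, ht⟩
  · rw [zString_empty, ctrl_one]
    exact Impl.one _ _
  obtain ⟨E, E', h1, h2, h3, h4⟩ := exists_parity_circuit d T t ht hT
  have hat : a ≠ t := fun e => ha (e ▸ ht)
  -- The tree does not touch `a`, so it need not be controlled: when the central `Z` is off, the
  -- tree and its inverse cancel.
  rw [← h4, ← mul_ctrl_mul h3 (h2.supportedOn.commute_onQubit ha _)
    (h2.supportedOn.commute_onQubit ha _)]
  have hg : Impl 1 (insert a T) (ctrl a (onQubit matZ t)) := by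
    refine (Impl.gate (Gate.cz a t hat)).mono_right ?_
    intro r hr
    simp only [Gate.qubits, Finset.mem_insert, Finset.mem_singleton] at hr ⊢
    rcases hr with rfl | rfl
    · exact Or.inl rfl
    · exact Or.inr ht
  have := ((h2.mono_right (Finset.subset_insert a T)).seq hg).seq
    (h1.mono_right (Finset.subset_insert a T))
  exact this.mono_left (by omega)

/-- The gate set has no single `Z`; it is written as `H X H`, on all qubits of `T` at once. -/
theorem Impl.zString (T : Finset Q) : Impl 3 T (zString T) := by
  induction T using Finset.induction_on with
  | empty => rw [zString_empty]; exact Impl.one _ _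
  | insert q T hq ih =>
    rw [zString_insert hq, Finset.insert_eq]
    refine Impl.par ?_ ih (by simpa using hq)
    rw [← matH_mul_matX_mul_matH, onQubit_mul, onQubit_mul]
    exact ((Impl.gate (Gate.had q)).seq (Impl.gate (Gate.x q))).seq (Impl.gate (Gate.had q))

end Circuits

/-! ### Ordered products -/

section Products

variable {M : Type*} [Monoid M]

theorem prod_map_mul_prod_map {ι : Type*} {f g : ι → M}
    (h : ∀ i j, i ≠ j → Commute (f i) (g j)) {L : List ι} (hL : L.Nodup) :
    (L.map f).prod * (L.map g).prod = (L.map fun i => f i * g i).prod := by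
  induction L with
  | nil => simp
  | cons i L ih =>
    rw [List.nodup_cons] at hL
    have hc : Commute (L.map f).prod (g i) := by
      refine Commute.list_prod_left _ _ fun a ha => ?_
      obtain ⟨j, hj, rfl⟩ := List.mem_map.1 ha
      exact h j i fun e => hL.1 (e ▸ hj)
    simp only [List.map_cons, List.prod_cons]
    rw [← ih hL.2, mul_assoc, ← mul_assoc (L.map f).prod, hc.eq]
    simp only [mul_assoc]

theorem prod_ofFn_mul_prod_ofFn {n : ℕ} {f g : Fin n → M}
    (h : ∀ i j, i ≠ j → Commute (f i) (g j)) :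
    (List.ofFn f).prod * (List.ofFn g).prod = (List.ofFn fun i => f i * g i).prod := by
  simp only [List.ofFn_eq_map]
  exact prod_map_mul_prod_map h (List.nodup_finRange n)

/-- The factors `P j` of the strings `S k = ∏_{j < k} P j` are collected at the position `j`. -/
theorem prod_ofFn_string {n : ℕ} (A P S : Fin n → M)
    (hS : ∀ k, S k = ((List.ofFn P).take k).prod) (hA : ∀ i j, i ≠ j → Commute (A i) (P j))
    (hP : ∀ i j, Commute (P i) (P j)) :
    (List.ofFn fun k => S k * A k).prod =
      (List.ofFn fun k : Fin n => A k * P k ^ (n - (k + 1))).prod := by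
  induction n with
  | zero => simp
  | succ n ih =>
    have hlast : S (Fin.last n) = (List.ofFn fun k : Fin n => P k.castSucc).prod := by
      rw [hS, List.ofFn_succ', List.concat_eq_append, List.take_left' (by simp)]
    have hcast : ∀ k : Fin n,
        S k.castSucc = ((List.ofFn fun j : Fin n => P j.castSucc).take k).prod := by
      intro k
      rw [hS, List.ofFn_succ', List.concat_eq_append,
        List.take_append_of_le_length (by simp [k.2.le])]
      rfl
    have key := ih (fun k => A k.castSucc) (fun k => P k.castSucc) (fun k => S k.castSucc) hcast
      (fun i j hij => hA _ _ fun e => hij (Fin.castSucc_injective n e)) (fun i j => hP _ _)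
    -- The string of the last factor contains every earlier `P j` once. Distributing it over the
    -- collected product raises each exponent by one.
    rw [List.ofFn_succ', List.concat_eq_append, List.prod_append, key, List.ofFn_succ',
      List.concat_eq_append, List.prod_append, List.prod_singleton, List.prod_singleton, hlast,
      ← mul_assoc, prod_ofFn_mul_prod_ofFn]
    · congr 2
      · congr 1
        funext k
        rw [mul_assoc, ← pow_succ]
        congr 2
        have := k.2
        simp only [Fin.val_castSucc]
        omega
      · simp
    · intro i j hij
      exact (hA _ _ fun e => hij (Fin.castSucc_injective n e)).mul_left ((hP _ _).pow_left _)

/-- `g` commutes past the factors in front of the first occurrence of `k` and is absorbed there. -/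
theorem mul_prod_map_eq_of_mem {ι : Type*} {f : ι → M} {g : M} {k : ι} (hk : g * f k = f k)
    (h : ∀ j, j ≠ k → Commute g (f j)) {L : List ι} (hL : k ∈ L) :
    g * (L.map f).prod = (L.map f).prod := by
  classical
  induction L with
  | nil => simp at hL
  | cons j L ih =>
    rw [List.map_cons, List.prod_cons]
    by_cases hj : j = k
    · rw [← mul_assoc, hj, hk]
    · rw [← mul_assoc, (h j hj).eq, mul_assoc,
        ih ((List.mem_cons.1 hL).resolve_left fun e => hj e.symm)]

end Products

/-! ### Jordan–Wigner strings -/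

section Fermions

variable {N ν : ℕ}

theorem string_commute_onQubit (l : Fin (ν + 1)) (i : Fin N) (A : Matrix (Fin 2) (Fin 2) ℂ) :
    Commute (strS i * strZlt i l : Op (SysQ N ν)) (onQubit A (i, l)) :=
  (zString_commute_onQubit A (by simp)).mul_left (zString_commute_onQubit A (by simp))

theorem modeB_conjTranspose (l : Fin (ν + 1)) (i : Fin N) :
    (modeB l i : Op (SysQ N ν))ᴴ = strS i * strZlt i l *
      ((2 : ℂ)⁻¹ • (onQubit matX (i, l) + Complex.I • onQubit matY (i, l))) := by
  have h : (strS i * strZlt i l : Op (SysQ N ν))ᴴ = strS i * strZlt i l := by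
    rw [Matrix.conjTranspose_mul, strS, strZlt, zString_conjTranspose, zString_conjTranspose,
      (zString_commute _ _).eq]
  have hc : Commute (strS i * strZlt i l : Op (SysQ N ν))
      ((2 : ℂ)⁻¹ • (onQubit matX (i, l) + Complex.I • onQubit matY (i, l))) :=
    ((string_commute_onQubit l i matX).add_right
      ((string_commute_onQubit l i matY).smul_right _)).smul_right _
  rw [modeB, Matrix.conjTranspose_mul, h, hc.eq, Matrix.conjTranspose_smul,
    Matrix.conjTranspose_sub, Matrix.conjTranspose_smul, onQubit_conjTranspose,
    onQubit_conjTranspose, matX_conjTranspose, matY_conjTranspose]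
  simp

theorem majC_eq (l : Fin (ν + 1)) (i : Fin N) :
    (majC l i : Op (SysQ N ν)) = strS i * strZlt i l * onQubit matX (i, l) := by
  rw [majC, modeB_conjTranspose, modeB, ← mul_add]
  congr 1
  module

theorem majD_eq (l : Fin (ν + 1)) (i : Fin N) :
    (majD l i : Op (SysQ N ν)) = -(strS i * strZlt i l * onQubit matY (i, l)) := by
  rw [majD, modeB_conjTranspose, modeB, ← mul_sub, ← mul_smul_comm, ← mul_neg]
  congr 1
  have : (-Complex.I) * (2⁻¹ * Complex.I + 2⁻¹ * Complex.I) = 1 := by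
    linear_combination -Complex.I_mul_I
  have h2 : ((2 : ℂ)⁻¹ • (onQubit matX (i, l) - Complex.I • onQubit matY (i, l)) -
      (2 : ℂ)⁻¹ • (onQubit matX (i, l) + Complex.I • onQubit matY (i, l)) : Op (SysQ N ν)) =
      -(2⁻¹ * Complex.I + 2⁻¹ * Complex.I) • onQubit matY (i, l) := by module
  rw [h2, smul_smul, mul_neg, this, neg_smul, one_smul]

end Fermions

/-! ### Pairs of sites and their strings. -/

section Ordered

variable {n ν : ℕ}

theorem fstSite_val (k : Fin n) : (fstSite k : ℕ) = 2 * k := rfl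

theorem sndSite_val (k : Fin n) : (sndSite k : ℕ) = 2 * k + 1 := rfl

theorem fstSite_ne_sndSite (k : Fin n) : fstSite k ≠ sndSite k := by
  intro h
  have := congrArg Fin.val h
  rw [fstSite_val, sndSite_val] at this
  omega

theorem mem_pairQubits {k : Fin n} {q : SysQ (2 * n) ν} :
    q ∈ pairQubits ν k ↔ q.1 = fstSite k ∨ q.1 = sndSite k := by
  simp [pairQubits]

theorem pairQubits_disjoint {k k' : Fin n} (h : k ≠ k') :
    Disjoint (pairQubits ν k) (pairQubits ν k') := by
  rw [Finset.disjoint_left]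
  intro q h1 h2
  rw [mem_pairQubits] at h1 h2
  simp only [Fin.ext_iff, fstSite_val, sndSite_val] at h1 h2
  exact h (Fin.ext (by omega))

theorem card_pairQubits (k : Fin n) : (pairQubits ν k).card = 2 * (ν + 1) := by
  have : pairQubits ν k = ({fstSite k, sndSite k} : Finset (Fin (2 * n))) ×ˢ Finset.univ := by
    ext q
    simp [mem_pairQubits]
  rw [this, Finset.card_product, Finset.card_pair (fstSite_ne_sndSite k)]
  simp

theorem strZall_mul_strZall (k : Fin n) :
    (strZall (fstSite k) * strZall (sndSite k) : Op (SysQ (2 * n) ν)) =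
      zString (pairQubits ν k) := by
  rw [strZall, strZall, ← zString_union]
  · congr 1
    ext q
    simp [mem_pairQubits]
  · rw [Finset.disjoint_filter]
    rintro q - h1 h2
    exact fstSite_ne_sndSite k (h1.symm.trans h2)

/-- This is the source of the full `Z` string on the first site in `bareD`: what remains of the
string is common to both sites of the pair. -/
theorem strS_sndSite (k : Fin n) :
    (strS (sndSite k) : Op (SysQ (2 * n) ν)) = strS (fstSite k) * strZall (fstSite k) := by
  rw [strS, strS, strZall, ← zString_union]
  · congr 1
    ext q
    simp only [Finset.mem_filter, Finset.mem_union, Finset.mem_univ, true_and, Fin.lt_def,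
      Fin.ext_iff, fstSite_val, sndSite_val]
    omega
  · rw [Finset.disjoint_filter]
    rintro q - h1 h2
    exact h1.ne h2

theorem strS_fstSite (k : Fin n) :
    (strS (fstSite k) : Op (SysQ (2 * n) ν)) =
      ((List.ofFn fun j : Fin n => zString (pairQubits ν j)).take k).prod := by
  have key : ∀ m : ℕ, m ≤ n →
      ((List.ofFn fun j : Fin n => zString (pairQubits ν j)).take m).prod =
        zString (Finset.univ.filter fun q : SysQ (2 * n) ν => (q.1 : ℕ) < 2 * m) := by
    intro m
    induction m with
    | zero => intro _; simp [zString_empty]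
    | succ m ih =>
      intro hm
      rw [List.prod_take_succ _ m (by simpa using hm), ih (by omega), List.getElem_ofFn,
        ← zString_union]
      · congr 1
        ext q
        simp only [Finset.mem_filter, Finset.mem_union, Finset.mem_univ, true_and, mem_pairQubits,
          Fin.ext_iff, fstSite_val, sndSite_val]
        omega
      · rw [Finset.disjoint_left]
        intro q h1 h2
        simp only [Finset.mem_filter, Finset.mem_univ, true_and, mem_pairQubits,
          Fin.ext_iff, fstSite_val, sndSite_val] at h1 h2
        omega
  rw [key k k.2.le]
  rfl

/-! ### The factors of the ordered product without their common string -/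

/-- `Z_{2k-1,<ℓ} X_{2k-1}^{(ℓ)}` -/
noncomputable def bareC (l : Fin (ν + 1)) (k : Fin n) : Op (SysQ (2 * n) ν) :=
  strZlt (fstSite k) l * onQubit matX (fstSite k, l)

/-- `-Z_{2k-1,≤ν} Z_{2k,<ℓ} Y_{2k}^{(ℓ)}` -/
noncomputable def bareD (l : Fin (ν + 1)) (k : Fin n) : Op (SysQ (2 * n) ν) :=
  -(strZall (fstSite k) * strZlt (sndSite k) l * onQubit matY (sndSite k, l))

theorem majC_fstSite (l : Fin (ν + 1)) (k : Fin n) :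
    (majC l (fstSite k) : Op (SysQ (2 * n) ν)) = strS (fstSite k) * bareC l k := by
  rw [majC_eq, bareC, mul_assoc]

theorem majD_sndSite (l : Fin (ν + 1)) (k : Fin n) :
    (majD l (sndSite k) : Op (SysQ (2 * n) ν)) = strS (fstSite k) * bareD l k := by
  rw [majD_eq, bareD, strS_sndSite]
  simp only [mul_assoc, mul_neg]

theorem localC_eq (l : Fin (ν + 1)) (k : Fin n) : localC l k = bareC l k * residualZ ν k := rfl

theorem localD_eq (l : Fin (ν + 1)) (k : Fin n) : localD l k = bareD l k * residualZ ν k := by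
  rw [localD, bareD, neg_mul]

theorem strZall_fstSite_mul_strZlt (l : Fin (ν + 1)) (k : Fin n) :
    (strZall (fstSite k) * strZlt (sndSite k) l : Op (SysQ (2 * n) ν)) =
      zString (Finset.univ.filter fun q => q.1 = fstSite k ∨ q.1 = sndSite k ∧ q.2 < l) := by
  rw [strZall, strZlt, ← zString_union]
  · congr 1
    ext q
    simp
  · rw [Finset.disjoint_filter]
    rintro q - h1 h2
    exact fstSite_ne_sndSite k (h1.symm.trans h2.1)

theorem bareC_supportedOn (l : Fin (ν + 1)) (k : Fin n) :
    SupportedOn (bareC l k) (pairQubits ν k) := by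
  refine ((zString_supportedOn _).mono fun q hq => ?_).mul
    (onQubit_supportedOn_of_mem _ (mem_pairQubits.2 (Or.inl rfl)))
  exact mem_pairQubits.2 (Or.inl (Finset.mem_filter.1 hq).2.1)

theorem bareD_supportedOn (l : Fin (ν + 1)) (k : Fin n) :
    SupportedOn (bareD l k) (pairQubits ν k) := by
  rw [bareD, strZall_fstSite_mul_strZlt]
  refine SupportedOn.neg (((zString_supportedOn _).mono fun q hq => ?_).mul
    (onQubit_supportedOn_of_mem _ (mem_pairQubits.2 (Or.inr rfl))))
  exact mem_pairQubits.2 ((Finset.mem_filter.1 hq).2.imp id And.left)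

theorem residualZ_eq (k : Fin n) :
    residualZ ν k = zString (pairQubits ν k) ^ (n - ((k : ℕ) + 1)) := by
  rw [residualZ, strZall_mul_strZall]

theorem residualZ_supportedOn (k : Fin n) : SupportedOn (residualZ ν k) (pairQubits ν k) := by
  rw [residualZ_eq]
  exact (zString_supportedOn _).pow _

theorem localC_supportedOn (l : Fin (ν + 1)) (k : Fin n) :
    SupportedOn (localC l k) (pairQubits ν k) :=
  (bareC_supportedOn l k).mul (residualZ_supportedOn k)

theorem localD_supportedOn (l : Fin (ν + 1)) (k : Fin n) :
    SupportedOn (localD l k) (pairQubits ν k) := by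
  rw [localD_eq]
  exact (bareD_supportedOn l k).mul (residualZ_supportedOn k)

/-- Locality of the ordered product, for arbitrary signs. -/
theorem signedProd_eq (l : Fin (ν + 1)) (m : Fin n → Fin 2) :
    signedProd l m = (List.ofFn fun k : Fin n =>
      localC l k - ((-1 : ℂ) ^ (m k : ℕ) * Complex.I) • localD l k).prod := by
  have h := prod_ofFn_string
    (fun k : Fin n => bareC l k - ((-1 : ℂ) ^ (m k : ℕ) * Complex.I) • bareD l k)
    (fun k => zString (pairQubits ν k)) (fun k => strS (fstSite k)) strS_fstSite
    (fun i j hij => ((bareC_supportedOn l i).sub ((bareD_supportedOn l i).smul _)).commute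
      (zString_supportedOn _) (pairQubits_disjoint hij)) (fun i j => zString_commute _ _)
  simpa only [signedProd, majC_fstSite, majD_sndSite, localC_eq, localD_eq, residualZ_eq, mul_sub,
    sub_mul, mul_smul_comm, smul_mul_assoc] using h

theorem signedProd_zero (l : Fin (ν + 1)) :
    signedProd l (0 : Fin n → Fin 2) =
      (List.ofFn fun k : Fin n => majC l (fstSite k) - Complex.I • majD l (sndSite k)).prod := by
  simp [signedProd]

/-! ### Clifford relations and the stabilizers -/

theorem bareC_mul_self (l : Fin (ν + 1)) (k : Fin n) : bareC l k * bareC l k = 1 := by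
  have h : Commute (strZlt (fstSite k) l) (onQubit matX (fstSite k, l)) :=
    zString_commute_onQubit matX (by simp)
  rw [bareC, mul_assoc, ← mul_assoc (onQubit _ _), ← h.eq, mul_assoc, ← onQubit_mul,
    matX_mul_self, onQubit_one, mul_one, strZlt, zString_mul_self]

theorem bareD_mul_self (l : Fin (ν + 1)) (k : Fin n) : bareD l k * bareD l k = 1 := by
  have h := zString_commute_onQubit (q := (sndSite k, l)) (T := Finset.univ.filter
    fun q : SysQ (2 * n) ν => q.1 = fstSite k ∨ q.1 = sndSite k ∧ q.2 < l) matY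
    (by simp [(fstSite_ne_sndSite k).symm])
  rw [bareD, strZall_fstSite_mul_strZlt, neg_mul_neg, mul_assoc, ← mul_assoc (onQubit _ _), ← h.eq,
    mul_assoc, ← onQubit_mul, matY_mul_self, onQubit_one, mul_one, zString_mul_self]

theorem bareC_mul_bareD (l : Fin (ν + 1)) (k : Fin n) :
    bareC l k * bareD l k = -(bareD l k * bareC l k) := by
  rw [bareD, strZall_fstSite_mul_strZlt, bareC, strZlt]
  set A : Finset (SysQ (2 * n) ν) := Finset.univ.filter fun q => q.1 = fstSite k ∧ q.2 < l
  set B : Finset (SysQ (2 * n) ν) :=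
    Finset.univ.filter fun q => q.1 = fstSite k ∨ q.1 = sndSite k ∧ q.2 < l
  -- This is the only sign: the `X` of the first site meets the full `Z` string of that site. All
  -- other factors of the two operators commute across.
  have h1 : zString B * onQubit matX (fstSite k, l) = -(onQubit matX (fstSite k, l) * zString B) :=
    zString_anticommute_onQubit matZ_mul_matX (by simp [B])
  have h2 : Commute (zString A) (onQubit matY (sndSite k, l)) :=
    zString_commute_onQubit matY (by simp [A])
  have h3 : Commute (onQubit matX (fstSite k, l)) (onQubit matY (sndSite k, l)) :=
    onQubit_commute _ _ fun h => fstSite_ne_sndSite k (Prod.ext_iff.1 h).1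
  have h4 := zString_commute A B
  generalize onQubit matX (fstSite k, l) = x at *
  generalize onQubit matY (sndSite k, l) = y at *
  generalize zString A = a at *
  generalize zString B = b at *
  calc a * x * -(b * y) = a * (-(x * b)) * y := by simp only [mul_assoc, mul_neg, neg_mul]
    _ = a * b * (x * y) := by rw [← h1]; simp only [mul_assoc]
    _ = b * (a * y) * x := by rw [h4.eq, h3.eq]; simp only [mul_assoc]
    _ = -(-(b * y) * (a * x)) := by rw [h2.eq]; simp only [mul_assoc, neg_mul, neg_neg]

/-- The common string commutes with `bareC` and squares to one, so it cancels and the stabilizer is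
local to its pair. -/
theorem stab_eq (l : Fin (ν + 1)) (k : Fin n) :
    (stab l (fstSite k) (sndSite k) : Op (SysQ (2 * n) ν)) =
      Complex.I • (bareC l k * bareD l k) := by
  have hd : Disjoint (Finset.univ.filter fun q : SysQ (2 * n) ν => q.1 < fstSite k)
      (pairQubits ν k) := by
    rw [Finset.disjoint_left]
    intro q h1 h2
    simp only [Finset.mem_filter, Finset.mem_univ, true_and, mem_pairQubits, Fin.lt_def,
      Fin.ext_iff, fstSite_val, sndSite_val] at h1 h2
    omega
  have hc : Commute (strS (fstSite k)) (bareC l k) :=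
    (zString_supportedOn _).commute (bareC_supportedOn l k) hd
  rw [stab, majC_fstSite, majD_sndSite, hc.eq, mul_assoc, ← mul_assoc (strS _), strS,
    zString_mul_self, one_mul]

theorem stab_supportedOn (l : Fin (ν + 1)) (k : Fin n) :
    SupportedOn (stab l (fstSite k) (sndSite k)) (pairQubits ν k) := by
  rw [stab_eq]
  exact ((bareC_supportedOn l k).mul (bareD_supportedOn l k)).smul _

/-- With `C` and `D` for `bareC` and `bareD`, anticommutation gives `CDC = -D` and `CDD = C`, so the
signed stabilizer exchanges the two terms. The residual string is a common right factor and plays no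
role. -/
theorem smul_stab_mul_local (l : Fin (ν + 1)) (k : Fin n) {s : ℂ} (hs : s * s = 1) :
    (s • stab l (fstSite k) (sndSite k)) * (localC l k - (s * Complex.I) • localD l k) =
      localC l k - (s * Complex.I) • localD l k := by
  have h1 : bareC l k * bareD l k * bareC l k = -bareD l k := by
    rw [bareC_mul_bareD, neg_mul, mul_assoc, bareC_mul_self, mul_one]
  have h2 : bareC l k * bareD l k * bareD l k = bareC l k := by
    rw [mul_assoc, bareD_mul_self, mul_one]
  have hs2 : s * Complex.I * (s * Complex.I) = -1 := by
    linear_combination Complex.I * Complex.I * hs + Complex.I_mul_I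
  rw [stab_eq, smul_smul, localC_eq, localD_eq, ← smul_mul_assoc (s * Complex.I) (bareD l k),
    ← sub_mul, ← mul_assoc]
  congr 1
  rw [mul_sub, smul_mul_assoc, h1, smul_mul_smul_comm, h2, hs2]
  module

theorem smul_stab_mul_signedProd (l : Fin (ν + 1)) (m : Fin n → Fin 2) (k : Fin n) :
    ((-1 : ℂ) ^ (m k : ℕ) • stab l (fstSite k) (sndSite k)) * signedProd l m = signedProd l m := by
  rw [signedProd_eq, List.ofFn_eq_map]
  refine mul_prod_map_eq_of_mem (f := fun j : Fin n =>
    localC l j - ((-1 : ℂ) ^ (m j : ℕ) * Complex.I) • localD l j)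
    (smul_stab_mul_local l k ?_) (fun j hj => ?_) (List.mem_finRange k)
  · rw [← pow_add, ← two_mul, pow_mul]
    simp
  · exact ((stab_supportedOn l k).smul _).commute
      ((localC_supportedOn l j).sub ((localD_supportedOn l j).smul _))
      (pairQubits_disjoint hj.symm)

end Ordered

section Ordered

variable {n ν : ℕ}

/-! ### System operators on the extended register -/

theorem afterOutcome_sysOp_mulVec (A : Op (SysQ (2 * n) ν)) (Φ : Ket (TotQ n ν))
    (m : Fin n → Fin 2) : afterOutcome (sysOp A *ᵥ Φ) m = A *ᵥ afterOutcome Φ m := by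
  funext s
  simp only [afterOutcome, Matrix.mulVec, dotProduct, sysOp, Matrix.of_apply]
  rw [← (Equiv.sumArrowEquivProdArrow (SysQ (2 * n) ν) (Fin n) (Fin 2)).symm.sum_comp,
    Fintype.sum_prod_type]
  refine Finset.sum_congr rfl fun t _ => ?_
  rw [Finset.sum_eq_single m]
  · simp [Equiv.sumArrowEquivProdArrow, Sum.elim_comp_inl]
  · intro b _ hb
    rw [if_neg, zero_mul]
    exact fun h => hb (funext fun k => (h k).symm)
  · simp

/-- The slices at all ancilla labels determine a vector. On slices a system operator acts as itself,
so identities for `sysOp` need no entrywise computation. -/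
theorem ext_afterOutcome {A B : Op (TotQ n ν)}
    (h : ∀ Φ m, afterOutcome (A *ᵥ Φ) m = afterOutcome (B *ᵥ Φ) m) : A = B := by
  refine Matrix.ext_of_mulVec_single fun i => funext fun x => ?_
  have := congrFun (h (Pi.single i 1) (x ∘ Sum.inr)) (x ∘ Sum.inl)
  simpa only [afterOutcome, Sum.elim_comp_inl_inr] using this

theorem sysOp_mul (A B : Op (SysQ (2 * n) ν)) : sysOp (A * B) = sysOp A * sysOp B := by
  refine ext_afterOutcome fun Φ m => ?_
  rw [← Matrix.mulVec_mulVec, afterOutcome_sysOp_mulVec, afterOutcome_sysOp_mulVec,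
    afterOutcome_sysOp_mulVec, Matrix.mulVec_mulVec]

theorem sysOp_one : sysOp (1 : Op (SysQ (2 * n) ν)) = 1 := by
  refine ext_afterOutcome fun Φ m => ?_
  rw [afterOutcome_sysOp_mulVec, Matrix.one_mulVec, Matrix.one_mulVec]

theorem sysOp_add (A B : Op (SysQ (2 * n) ν)) : sysOp (A + B) = sysOp A + sysOp B := by
  ext x y
  simp only [sysOp, Matrix.of_apply, Matrix.add_apply]
  split_ifs <;> simp

theorem sysOp_sub (A B : Op (SysQ (2 * n) ν)) : sysOp (A - B) = sysOp A - sysOp B := by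
  ext x y
  simp only [sysOp, Matrix.of_apply, Matrix.sub_apply]
  split_ifs <;> simp

theorem sysOp_conjTranspose (A : Op (SysQ (2 * n) ν)) : (sysOp A)ᴴ = sysOp Aᴴ := by
  ext x y
  simp only [sysOp, Matrix.of_apply, Matrix.conjTranspose_apply, apply_ite star, star_zero,
    eq_comm]

theorem sysOp_onQubit (A : Matrix (Fin 2) (Fin 2) ℂ) (q : SysQ (2 * n) ν) :
    sysOp (onQubit A q) = onQubit A (Sum.inl q : TotQ n ν) := by
  ext x y
  simp only [sysOp, onQubit, Matrix.of_apply, Function.comp_apply, Sum.forall, ne_eq,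
    Sum.inl.injEq, reduceCtorEq, not_false_eq_true, true_imp_iff, ← ite_and]
  refine if_congr ?_ rfl rfl
  tauto

theorem sysOp_zString (T : Finset (SysQ (2 * n) ν)) :
    (sysOp (zString T) : Op (TotQ n ν)) = zString (T.map Function.Embedding.inl) := by
  induction T using Finset.induction_on with
  | empty => rw [zString_empty, sysOp_one, Finset.map_empty, zString_empty]
  | insert q T hq ih =>
    rw [zString_insert hq, sysOp_mul, ih, Finset.map_insert, zString_insert (by simpa using hq),
      sysOp_onQubit]
    rfl

theorem afterOutcome_onQubit_mulVec (A : Matrix (Fin 2) (Fin 2) ℂ) (k : Fin n)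
    (Φ : Ket (TotQ n ν)) (m : Fin n → Fin 2) :
    afterOutcome (onQubit A (Sum.inr k) *ᵥ Φ) m =
      ∑ b, A (m k) b • afterOutcome Φ (Function.update m k b) := by
  funext s
  rw [afterOutcome, onQubit_mulVec_apply, Finset.sum_apply]
  refine Finset.sum_congr rfl fun b _ => ?_
  rw [Sum.update_elim_inr]
  rfl

theorem sysOp_commute_onQubit_inr (B : Op (SysQ (2 * n) ν)) (A : Matrix (Fin 2) (Fin 2) ℂ)
    (k : Fin n) : Commute (onQubit A (Sum.inr k : TotQ n ν)) (sysOp B) := by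
  refine ext_afterOutcome fun Φ m => ?_
  rw [← Matrix.mulVec_mulVec, ← Matrix.mulVec_mulVec, afterOutcome_sysOp_mulVec,
    afterOutcome_onQubit_mulVec, afterOutcome_onQubit_mulVec]
  simp only [afterOutcome_sysOp_mulVec, Fin.sum_univ_two, Matrix.mulVec_add, Matrix.mulVec_smul]

theorem sysOp_supportedOn {A : Op (SysQ (2 * n) ν)} {T : Finset (SysQ (2 * n) ν)}
    (h : SupportedOn A T) : SupportedOn (sysOp A) (T.map Function.Embedding.inl) := by
  rw [supportedOn_iff_commute] at *
  rintro (q | k) hq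
  · have := h q (by simpa using hq)
    rw [← sysOp_onQubit, ← sysOp_onQubit]
    constructor
    · rw [Commute, SemiconjBy, ← sysOp_mul, ← sysOp_mul, this.1.eq]
    · rw [Commute, SemiconjBy, ← sysOp_mul, ← sysOp_mul, this.2.eq]
  · exact ⟨(sysOp_commute_onQubit_inr A _ k).symm, (sysOp_commute_onQubit_inr A _ k).symm⟩

theorem sysOp_mem_unitary {A : Op (SysQ (2 * n) ν)}
    (h : A ∈ Matrix.unitaryGroup (Basis (SysQ (2 * n) ν)) ℂ) :
    sysOp A ∈ Matrix.unitaryGroup (Basis (TotQ n ν)) ℂ := by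
  rw [Matrix.mem_unitaryGroup_iff', Matrix.star_eq_conjTranspose] at *
  rw [sysOp_conjTranspose, ← sysOp_mul, h, sysOp_one]

/-! ### Blocks -/

theorem map_inl_subset_blockQubits {k : Fin n} {T : Finset (SysQ (2 * n) ν)}
    (h : T ⊆ pairQubits ν k) : T.map Function.Embedding.inl ⊆ blockQubits ν k := by
  intro q hq
  obtain ⟨r, hr, rfl⟩ := Finset.mem_map.1 hq
  exact Finset.inl_mem_disjSum.2 (h hr)

theorem inr_mem_blockQubits (k : Fin n) : (Sum.inr k : TotQ n ν) ∈ blockQubits ν k :=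
  Finset.inr_mem_disjSum.2 (Finset.mem_singleton_self k)

theorem blockQubits_disjoint {k k' : Fin n} (h : k ≠ k') :
    Disjoint (blockQubits ν k) (blockQubits ν k') := by
  rw [Finset.disjoint_left]
  rintro (q | j) h1 h2
  · exact Finset.disjoint_left.1 (pairQubits_disjoint h) (Finset.inl_mem_disjSum.1 h1)
      (Finset.inl_mem_disjSum.1 h2)
  · have e1 := Finset.mem_singleton.1 (Finset.inr_mem_disjSum.1 h1)
    have e2 := Finset.mem_singleton.1 (Finset.inr_mem_disjSum.1 h2)
    exact h (e1.symm.trans e2)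

theorem uLocal_supportedOn (l : Fin (ν + 1)) (k : Fin n) :
    SupportedOn (uLocal l k) (blockQubits ν k) :=
  ((onQubit_supportedOn_of_mem _ (inr_mem_blockQubits k)).mul
    ((sysOp_supportedOn (localC_supportedOn l k)).mono
      (map_inl_subset_blockQubits subset_rfl))).add
  ((onQubit_supportedOn_of_mem _ (inr_mem_blockQubits k)).mul
    ((sysOp_supportedOn ((localD_supportedOn l k).smul _)).mono
      (map_inl_subset_blockQubits subset_rfl)))

/-! ### Unitarity -/

theorem residualZ_mem_unitary (k : Fin n) :
    residualZ ν k ∈ Matrix.unitaryGroup (Basis (SysQ (2 * n) ν)) ℂ := by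
  rw [residualZ_eq]
  exact pow_mem (zString_mem_unitary _) _

theorem localC_mem_unitary (l : Fin (ν + 1)) (k : Fin n) :
    localC l k ∈ Matrix.unitaryGroup (Basis (SysQ (2 * n) ν)) ℂ :=
  mul_mem (mul_mem (zString_mem_unitary _)
    (onQubit_mem_unitary (by rw [matX_conjTranspose, matX_mul_self]) _)) (residualZ_mem_unitary k)

theorem smul_localD_mem_unitary (l : Fin (ν + 1)) (k : Fin n) :
    (-Complex.I) • localD l k ∈ Matrix.unitaryGroup (Basis (SysQ (2 * n) ν)) ℂ := by
  have h : (-Complex.I) • localD l k = strZall (fstSite k) * strZlt (sndSite k) l *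
      onQubit (Complex.I • matY) (sndSite k, l) * residualZ ν k := by
    rw [localD, smul_neg, neg_smul, neg_neg, onQubit_smul, mul_smul_comm, smul_mul_assoc]
  rw [h]
  refine mul_mem (mul_mem (mul_mem (zString_mem_unitary _) (zString_mem_unitary _))
    (onQubit_mem_unitary ?_ _)) (residualZ_mem_unitary k)
  rw [Matrix.conjTranspose_smul, matY_conjTranspose, smul_mul_smul_comm, matY_mul_self]
  simp

theorem uLocal_mem_unitary (l : Fin (ν + 1)) (k : Fin n) :
    uLocal l k ∈ Matrix.unitaryGroup (Basis (TotQ n ν)) ℂ := by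
  have hC := sysOp_mem_unitary (localC_mem_unitary l k)
  have hD := sysOp_mem_unitary (smul_localD_mem_unitary l k)
  rw [Matrix.mem_unitaryGroup_iff, Matrix.star_eq_conjTranspose] at hC hD ⊢
  have h00 : onQubit proj0 (Sum.inr k : TotQ n ν) * onQubit proj0 (Sum.inr k) =
      onQubit proj0 (Sum.inr k) := by
    rw [← onQubit_mul, proj0_mul_self]
  have h11 : onQubit proj1 (Sum.inr k : TotQ n ν) * onQubit proj1 (Sum.inr k) =
      onQubit proj1 (Sum.inr k) := by
    rw [← onQubit_mul, proj1_mul_self]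
  have h01 : onQubit proj0 (Sum.inr k : TotQ n ν) * onQubit proj1 (Sum.inr k) = 0 := by
    rw [← onQubit_mul, proj0_mul_proj1, onQubit_zero]
  have h10 : onQubit proj1 (Sum.inr k : TotQ n ν) * onQubit proj0 (Sum.inr k) = 0 := by
    rw [← onQubit_mul, proj1_mul_proj0, onQubit_zero]
  have hP := proj0_add_proj1_onQubit (Sum.inr k : TotQ n ν)
  have e : (uLocal l k)ᴴ = (sysOp (localC l k))ᴴ * onQubit proj0 (Sum.inr k) +
      (sysOp ((-Complex.I) • localD l k))ᴴ * onQubit proj1 (Sum.inr k) := by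
    rw [uLocal, Matrix.conjTranspose_add, Matrix.conjTranspose_mul, Matrix.conjTranspose_mul,
      onQubit_conjTranspose, onQubit_conjTranspose, proj0_conjTranspose, proj1_conjTranspose]
  have s0 : ∀ B : Op (SysQ (2 * n) ν), sysOp B * onQubit proj0 (Sum.inr k) =
      onQubit proj0 (Sum.inr k) * sysOp B := fun B => (sysOp_commute_onQubit_inr B proj0 k).eq.symm
  have s1 : ∀ B : Op (SysQ (2 * n) ν), sysOp B * onQubit proj1 (Sum.inr k) =
      onQubit proj1 (Sum.inr k) * sysOp B := fun B => (sysOp_commute_onQubit_inr B proj1 k).eq.symm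
  rw [e]
  rw [sysOp_conjTranspose, sysOp_conjTranspose] at *
  rw [s0, s1, uLocal, mul_add, add_mul, add_mul]
  generalize sysOp (localC l k)ᴴ = C' at *
  generalize sysOp ((-Complex.I) • localD l k)ᴴ = D' at *
  have t0 := s0 (localC l k)
  have t0' := s0 ((-Complex.I) • localD l k)
  have t1 := s1 (localC l k)
  have t1' := s1 ((-Complex.I) • localD l k)
  generalize sysOp (localC l k) = C at *
  generalize sysOp ((-Complex.I) • localD l k) = D at *
  generalize onQubit proj0 (Sum.inr k : TotQ n ν) = P at *
  generalize onQubit proj1 (Sum.inr k : TotQ n ν) = R at *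
  -- The ancilla projections pass the system operators; the mixed terms vanish by orthogonality and
  -- the other two add up to the identity.
  calc P * C * (P * C') + R * D * (P * C') + (P * C * (R * D') + R * D * (R * D'))
      = P * (C * P) * C' + R * (D * P) * C' + (P * (C * R) * D' + R * (D * R) * D') := by
        simp only [mul_assoc]
    _ = (P * P) * (C * C') + (R * P) * (D * C') + ((P * R) * (C * D') + (R * R) * (D * D')) := by
        rw [t0, t0', t1, t1']; simp only [mul_assoc]
    _ = 1 := by rw [h00, h11, h01, h10, hC, hD]; simpa using hP

theorem uOrd_mem_unitary (l : Fin (ν + 1)) :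
    (uOrd l : Op (TotQ n ν)) ∈ Matrix.unitaryGroup (Basis (TotQ n ν)) ℂ := by
  refine list_prod_mem fun A hA => ?_
  obtain ⟨k, rfl⟩ := List.mem_ofFn.1 hA
  exact uLocal_mem_unitary l k

theorem hadAnc_mem_unitary : hadAnc n ν ∈ Matrix.unitaryGroup (Basis (TotQ n ν)) ℂ := by
  refine list_prod_mem fun A hA => ?_
  obtain ⟨k, rfl⟩ := List.mem_ofFn.1 hA
  exact onQubit_mem_unitary (by rw [matH_conjTranspose, matH_mul_self]) _

theorem uPrep_mem_unitary (l : Fin (ν + 1)) :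
    (uPrep l : Op (TotQ n ν)) ∈ Matrix.unitaryGroup (Basis (TotQ n ν)) ℂ :=
  mul_mem (mul_mem hadAnc_mem_unitary (uOrd_mem_unitary l)) hadAnc_mem_unitary

/-! ### Measurement of the ancillas -/

theorem uPrep_eq (l : Fin (ν + 1)) :
    (uPrep l : Op (TotQ n ν)) = (List.ofFn fun k : Fin n =>
      onQubit matH (Sum.inr k) * uLocal l k * onQubit matH (Sum.inr k)).prod := by
  have h : ∀ i j : Fin n, i ≠ j →
      Commute (onQubit matH (Sum.inr i : TotQ n ν)) (uLocal l j) := fun i j hij =>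
    (onQubit_supportedOn_of_mem matH (inr_mem_blockQubits i)).commute (uLocal_supportedOn l j)
      (blockQubits_disjoint hij)
  have h' : ∀ i j : Fin n, i ≠ j →
      Commute (onQubit matH (Sum.inr i : TotQ n ν)) (onQubit matH (Sum.inr j)) :=
    fun i j hij => onQubit_commute _ _ fun e => hij (Sum.inr.inj e)
  rw [uPrep, hadAnc, uOrd, prod_ofFn_mul_prod_ofFn h, prod_ofFn_mul_prod_ofFn fun i j hij =>
    (h' i j hij).mul_left (h j i hij.symm).symm]

theorem matH_conj_uLocal (l : Fin (ν + 1)) (k : Fin n) :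
    onQubit matH (Sum.inr k) * uLocal l k * onQubit matH (Sum.inr k) =
      (2⁻¹ : ℂ) • (sysOp (localC l k + (-Complex.I) • localD l k) +
        onQubit matX (Sum.inr k) * sysOp (localC l k - (-Complex.I) • localD l k)) := by
  have hc : ∀ B : Op (SysQ (2 * n) ν), sysOp B * onQubit matH (Sum.inr k) =
      onQubit matH (Sum.inr k) * sysOp B := fun B => (sysOp_commute_onQubit_inr B matH k).eq.symm
  have h0 : onQubit matH (Sum.inr k : TotQ n ν) * onQubit proj0 (Sum.inr k) *
      onQubit matH (Sum.inr k) = (2⁻¹ : ℂ) • (1 + onQubit matX (Sum.inr k)) := by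
    rw [← onQubit_mul, ← onQubit_mul, matH_mul_proj0_mul_matH, onQubit_smul, onQubit_add,
      onQubit_one]
  have h1 : onQubit matH (Sum.inr k : TotQ n ν) * onQubit proj1 (Sum.inr k) *
      onQubit matH (Sum.inr k) = (2⁻¹ : ℂ) • (1 - onQubit matX (Sum.inr k)) := by
    rw [← onQubit_mul, ← onQubit_mul, matH_mul_proj1_mul_matH, onQubit_smul, sub_eq_add_neg,
      onQubit_add, onQubit_one, ← neg_one_smul ℂ matX, onQubit_smul, neg_one_smul, sub_eq_add_neg]
  rw [uLocal, mul_add, add_mul, mul_assoc, mul_assoc, hc, mul_assoc, mul_assoc, hc,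
    ← mul_assoc (onQubit proj0 _), ← mul_assoc (onQubit matH _), ← mul_assoc (onQubit matH _), h0,
    ← mul_assoc (onQubit proj1 _), ← mul_assoc (onQubit matH _), ← mul_assoc (onQubit matH _), h1,
    sysOp_add, sysOp_sub, smul_mul_assoc, smul_mul_assoc, ← smul_add]
  congr 1
  noncomm_ring

theorem afterOutcome_matX_mulVec (Φ : Ket (TotQ n ν)) (k : Fin n) (m : Fin n → Fin 2) :
    afterOutcome (onQubit matX (Sum.inr k) *ᵥ Φ) m =
      afterOutcome Φ (Function.update m k (1 - m k)) := by
  rw [afterOutcome_onQubit_mulVec, Fin.sum_univ_two]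
  generalize m k = b
  fin_cases b <;> simp [matX]

theorem afterOutcome_add (Φ Ψ : Ket (TotQ n ν)) (m : Fin n → Fin 2) :
    afterOutcome (Φ + Ψ) m = afterOutcome Φ m + afterOutcome Ψ m := rfl

theorem afterOutcome_smul (a : ℂ) (Φ : Ket (TotQ n ν)) (m : Fin n → Fin 2) :
    afterOutcome (a • Φ) m = a • afterOutcome Φ m := rfl

/-- Stated for partial products to permit induction: an ancilla whose block has not been applied is
still zero, hence the condition outside `L`. -/
theorem afterOutcome_prod_mulVec (l : Fin (ν + 1)) (ψ : Ket (SysQ (2 * n) ν)) {L : List (Fin n)}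
    (hL : L.Nodup) (m : Fin n → Fin 2) :
    afterOutcome ((L.map fun k => onQubit matH (Sum.inr k) * uLocal l k *
        onQubit matH (Sum.inr k)).prod *ᵥ withZeroAnc ψ) m =
      if ∀ k, k ∉ L → m k = 0 then
        ((2 : ℂ)⁻¹) ^ L.length • ((L.map fun k =>
          localC l k - ((-1 : ℂ) ^ (m k : ℕ) * Complex.I) • localD l k).prod *ᵥ ψ)
      else 0 := by
  induction L generalizing m with
  | nil =>
    funext s
    simp only [List.map_nil, List.prod_nil, Matrix.one_mulVec, afterOutcome, withZeroAnc,
      Sum.elim_inr, List.not_mem_nil, not_false_eq_true, true_imp_iff, List.length_nil, pow_zero,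
      one_smul, Sum.elim_comp_inl]
    split_ifs with h
    · exact if_pos h
    · exact if_neg h
  | cons k L ih =>
    rw [List.nodup_cons] at hL
    have hmap : ∀ b, (L.map fun j => localC l j -
        ((-1 : ℂ) ^ (Function.update m k b j : ℕ) * Complex.I) • localD l j) =
        L.map fun j => localC l j - ((-1 : ℂ) ^ (m j : ℕ) * Complex.I) • localD l j := by
      intro b
      refine List.map_congr_left fun j hj => ?_
      have hjk : j ≠ k := fun e => hL.1 (e ▸ hj)
      rw [Function.update_of_ne hjk]
    rw [List.map_cons, List.prod_cons, matH_conj_uLocal, ← Matrix.mulVec_mulVec,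
      Matrix.smul_mulVec, Matrix.add_mulVec, afterOutcome_smul, afterOutcome_add,
      ← Matrix.mulVec_mulVec, afterOutcome_matX_mulVec, afterOutcome_sysOp_mulVec,
      afterOutcome_sysOp_mulVec, ih hL.2, ih hL.2, hmap, List.map_cons, List.prod_cons,
      ← Matrix.mulVec_mulVec, List.length_cons, pow_succ']
    have hfin : m k = 0 ∨ m k = 1 := by
      generalize m k = b
      fin_cases b <;> simp
    -- The ancilla `k` is still zero before its block acts. Outcome zero therefore keeps only the
    -- term without the flip, outcome one only the term with it, and this fixes the sign in the
    -- factor.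
    rcases hfin with hk | hk
    · have e1 : (∀ j, j ∉ L → m j = 0) ↔ ∀ j, j ∉ k :: L → m j = 0 := by
        constructor
        · exact fun h j hj => h j fun hj' => hj (List.mem_cons_of_mem k hj')
        · intro h j hj
          by_cases hjk : j = k
          · rw [hjk, hk]
          · exact h j (by simp [hjk, hj])
      have e2 : ¬ ∀ j, j ∉ L → Function.update m k (1 - m k) j = 0 := by
        intro h
        have := h k hL.1
        rw [Function.update_self, hk] at this
        exact absurd this (by decide)
      rw [if_neg e2, Matrix.mulVec_zero, add_zero, hk]
      simp only [e1]
      split_ifs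
      · simp only [Fin.val_zero, pow_zero, one_mul, neg_smul, ← sub_eq_add_neg,
          Matrix.mulVec_smul, smul_smul]
      · simp
    · have e1 : (∀ j, j ∉ L → Function.update m k (1 - m k) j = 0) ↔
          ∀ j, j ∉ k :: L → m j = 0 := by
        constructor
        · intro h j hj
          rw [List.mem_cons, not_or] at hj
          have := h j hj.2
          rwa [Function.update_of_ne hj.1] at this
        · intro h j hj
          by_cases hjk : j = k
          · rw [hjk, Function.update_self, hk, sub_self]
          · rw [Function.update_of_ne hjk]
            exact h j (by simp [hjk, hj])
      have e2 : ¬ ∀ j, j ∉ L → m j = 0 := by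
        intro h
        have := h k hL.1
        rw [hk] at this
        exact absurd this (by decide)
      rw [if_neg e2, Matrix.mulVec_zero, zero_add, if_congr e1 rfl rfl, hk]
      split_ifs
      · simp only [Fin.val_one, pow_one, neg_mul, one_mul, Matrix.mulVec_smul, smul_smul]
      · simp

theorem afterOutcome_uPrep (l : Fin (ν + 1)) (ψ : Ket (SysQ (2 * n) ν)) (m : Fin n → Fin 2) :
    afterOutcome (uPrep l *ᵥ withZeroAnc ψ) m = ((2 : ℂ) ^ n)⁻¹ • (signedProd l m *ᵥ ψ) := by
  rw [uPrep_eq, List.ofFn_eq_map, afterOutcome_prod_mulVec l ψ (List.nodup_finRange n) m,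
    if_pos fun k hk => absurd (List.mem_finRange k) hk, signedProd_eq, List.ofFn_eq_map,
    List.length_finRange, inv_pow]

theorem cOrd_eq_signedProd (l : Fin (ν + 1)) :
    (cOrd l : Op (SysQ (2 * n) ν)) =
      (((2 : ℝ) ^ (((2 * n : ℕ) : ℝ) / 4) : ℝ) : ℂ)⁻¹ • signedProd l 0 := by
  rw [cOrd, signedProd_zero]

theorem two_rpow_mul_self (n : ℕ) :
    (((2 : ℝ) ^ (((2 * n : ℕ) : ℝ) / 4) : ℝ) : ℂ)⁻¹ *
      (((2 : ℝ) ^ (((2 * n : ℕ) : ℝ) / 4) : ℝ) : ℂ)⁻¹ = ((2 : ℂ) ^ n)⁻¹ := by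
  rw [← mul_inv, ← Complex.ofReal_mul, ← Real.rpow_add (by norm_num)]
  have : ((2 * n : ℕ) : ℝ) / 4 + ((2 * n : ℕ) : ℝ) / 4 = (n : ℝ) := by push_cast; ring
  rw [this, Real.rpow_natCast]
  push_cast
  rfl

/-! ### Circuits -/

/-- Conjugation with `X` on the ancilla turns control on one into control on zero. The residual
string occurs in both branches and stays uncontrolled. -/
theorem uLocal_eq (l : Fin (ν + 1)) (k : Fin n) :
    uLocal l k = onQubit matX (Sum.inr k) * ctrl (Sum.inr k) (sysOp (bareC l k)) *
      onQubit matX (Sum.inr k) * ctrl (Sum.inr k) (sysOp ((-Complex.I) • bareD l k)) *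
        sysOp (residualZ ν k) := by
  have c0 := (sysOp_commute_onQubit_inr (bareC l k) proj0 k).eq
  have c1 := (sysOp_commute_onQubit_inr (bareC l k) proj1 k).eq
  have cX := (sysOp_commute_onQubit_inr (bareC l k) matX k).eq
  have h00 : onQubit proj0 (Sum.inr k : TotQ n ν) * onQubit proj0 (Sum.inr k) =
      onQubit proj0 (Sum.inr k) := by
    rw [← onQubit_mul, proj0_mul_self]
  have h11 : onQubit proj1 (Sum.inr k : TotQ n ν) * onQubit proj1 (Sum.inr k) =
      onQubit proj1 (Sum.inr k) := by
    rw [← onQubit_mul, proj1_mul_self]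
  have h01 : onQubit proj0 (Sum.inr k : TotQ n ν) * onQubit proj1 (Sum.inr k) = 0 := by
    rw [← onQubit_mul, proj0_mul_proj1, onQubit_zero]
  have h10 : onQubit proj1 (Sum.inr k : TotQ n ν) * onQubit proj0 (Sum.inr k) = 0 := by
    rw [← onQubit_mul, proj1_mul_proj0, onQubit_zero]
  have x0 : onQubit matX (Sum.inr k : TotQ n ν) * onQubit proj0 (Sum.inr k) *
      onQubit matX (Sum.inr k) = onQubit proj1 (Sum.inr k) := by
    rw [← onQubit_mul, ← onQubit_mul, matX_mul_proj0_mul_matX]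
  have x1 : onQubit matX (Sum.inr k : TotQ n ν) * onQubit proj1 (Sum.inr k) *
      onQubit matX (Sum.inr k) = onQubit proj0 (Sum.inr k) := by
    rw [← onQubit_mul, ← onQubit_mul, matX_mul_proj1_mul_matX]
  rw [uLocal, localC_eq, localD_eq, ← smul_mul_assoc, sysOp_mul, sysOp_mul, ← mul_assoc,
    ← mul_assoc, ← add_mul, ctrl, ctrl]
  congr 1
  generalize sysOp (bareC l k) = C at *
  generalize sysOp ((-Complex.I) • bareD l k) = D at *
  generalize onQubit proj0 (Sum.inr k : TotQ n ν) = P at *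
  generalize onQubit proj1 (Sum.inr k : TotQ n ν) = R at *
  generalize onQubit matX (Sum.inr k : TotQ n ν) = X at *
  have e : X * (P + R * C) * X = R + P * C := by
    rw [mul_add, add_mul, x0, mul_assoc, mul_assoc, ← cX, ← mul_assoc R, ← mul_assoc X,
      ← mul_assoc X, x1]
  rw [e, add_mul, mul_add, mul_add, h10, ← mul_assoc R, h11, mul_assoc P, ← c0, ← mul_assoc P, h00,
    mul_assoc P, ← mul_assoc C, ← c1, mul_assoc R, ← mul_assoc P, h01]
  simp [add_comm]

theorem sysOp_bareC (l : Fin (ν + 1)) (k : Fin n) :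
    sysOp (bareC l k) =
      zString ((Finset.univ.filter fun q : SysQ (2 * n) ν => q.1 = fstSite k ∧ q.2 < l).map
        Function.Embedding.inl) * onQubit matX (Sum.inl (fstSite k, l)) := by
  rw [bareC, strZlt, sysOp_mul, sysOp_zString, sysOp_onQubit]

/-- By `iY = ZX` the phase is absorbed exactly and the `Z` string gains one qubit, so no phase gate
is required. -/
theorem sysOp_smul_bareD (l : Fin (ν + 1)) (k : Fin n) :
    sysOp ((-Complex.I) • bareD l k) =
      zString ((insert (sndSite k, l) (Finset.univ.filter fun q : SysQ (2 * n) ν =>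
        q.1 = fstSite k ∨ q.1 = sndSite k ∧ q.2 < l)).map Function.Embedding.inl) *
          onQubit matX (Sum.inl (sndSite k, l)) := by
  have hn : (sndSite k, l) ∉ Finset.univ.filter fun q : SysQ (2 * n) ν =>
      q.1 = fstSite k ∨ q.1 = sndSite k ∧ q.2 < l := by
    simp [(fstSite_ne_sndSite k).symm]
  rw [← sysOp_zString, ← sysOp_onQubit, ← sysOp_mul, bareD, strZall_fstSite_mul_strZlt, smul_neg,
    neg_smul, neg_neg, ← mul_smul_comm, ← onQubit_smul, I_smul_matY, onQubit_mul,
    zString_insert hn, ← (zString_commute_onQubit matZ hn).eq, mul_assoc]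

theorem Impl.ctrl_zString_mul_matX {d : ℕ} {k : Fin n} {T : Finset (SysQ (2 * n) ν)}
    {q : SysQ (2 * n) ν} (hT : T ⊆ pairQubits ν k) (hq : q ∈ pairQubits ν k)
    (hd : 2 * (ν + 1) ≤ 2 ^ d) :
    Impl (2 * d + 2) (blockQubits ν k) (ctrl (Sum.inr k)
      (OrderedPrep.zString (T.map Function.Embedding.inl) * onQubit matX (Sum.inl q))) := by
  have hk : (Sum.inr k : TotQ n ν) ∉ T.map Function.Embedding.inl := by simp
  rw [ctrl_mul (zString_commute_onQubit _ hk).symm (zString_commute_onQubit _ hk).symm]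
  have hcard : (T.map (Function.Embedding.inl : _ ↪ TotQ n ν)).card ≤ 2 ^ d := by
    rw [Finset.card_map]
    exact ((Finset.card_le_card hT).trans (card_pairQubits k).le).trans hd
  refine Impl.seq (D := 2 * d + 1) (D' := 1) ((Impl.ctrl_zString hk hcard).mono_right ?_)
    ((Impl.gate (Gate.cx (Sum.inr k : TotQ n ν) (Sum.inl q) (by simp))).mono_right ?_)
  · exact Finset.insert_subset (inr_mem_blockQubits k) (map_inl_subset_blockQubits hT)
  · intro r hr
    simp only [Gate.qubits, Finset.mem_insert, Finset.mem_singleton] at hr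
    rcases hr with rfl | rfl
    · exact inr_mem_blockQubits k
    · exact Finset.inl_mem_disjSum.2 hq

/-- Only the parity of the exponent matters, which keeps the depth independent of `n`. -/
theorem Impl.sysOp_residualZ (k : Fin n) :
    Impl 3 (blockQubits ν k) (sysOp (residualZ ν k)) := by
  rw [residualZ_eq]
  rcases Nat.even_or_odd' (n - ((k : ℕ) + 1)) with ⟨r, h | h⟩
  · rw [h, pow_mul, pow_two, zString_mul_self, one_pow, sysOp_one]
    exact Impl.one _ _
  · rw [h, pow_succ, pow_mul, pow_two, zString_mul_self, one_pow, one_mul, sysOp_zString]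
    exact (Impl.zString _).mono_right (map_inl_subset_blockQubits subset_rfl)

theorem Impl.uLocal (l : Fin (ν + 1)) (k : Fin n) {d : ℕ} (hd : 2 * (ν + 1) ≤ 2 ^ d) :
    Impl (4 * d + 9) (blockQubits ν k) (uLocal l k) := by
  have hX : Impl 1 (blockQubits ν k) (onQubit matX (Sum.inr k)) :=
    (Impl.gate (Gate.x (Sum.inr k : TotQ n ν))).mono_right
      (Finset.singleton_subset_iff.2 (inr_mem_blockQubits k))
  rw [uLocal_eq, sysOp_bareC, sysOp_smul_bareD]
  have hC := Impl.ctrl_zString_mul_matX (k := k) (q := (fstSite k, l))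
    (T := Finset.univ.filter fun q : SysQ (2 * n) ν => q.1 = fstSite k ∧ q.2 < l)
    (fun q hq => mem_pairQubits.2 (Or.inl (Finset.mem_filter.1 hq).2.1))
    (mem_pairQubits.2 (Or.inl rfl)) hd
  have hD := Impl.ctrl_zString_mul_matX (k := k) (q := (sndSite k, l))
    (T := insert (sndSite k, l) (Finset.univ.filter fun q : SysQ (2 * n) ν =>
        q.1 = fstSite k ∨ q.1 = sndSite k ∧ q.2 < l))
    (Finset.insert_subset (mem_pairQubits.2 (Or.inr rfl)) fun q hq =>
      mem_pairQubits.2 ((Finset.mem_filter.1 hq).2.imp id And.left))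
    (mem_pairQubits.2 (Or.inr rfl)) hd
  -- The depths are `1 + (2d + 2) + 1 + (2d + 2) + 3 = 4d + 9`.
  exact ((((hX.seq hC).seq hX).seq hD).seq (Impl.sysOp_residualZ k)).mono_left (by omega)

theorem Impl.uOrd (l : Fin (ν + 1)) {d : ℕ} (hd : 2 * (ν + 1) ≤ 2 ^ d) :
    Impl (4 * d + 9) Finset.univ (uOrd l : Op (TotQ n ν)) := by
  rw [OrderedPrep.uOrd, List.ofFn_eq_map]
  exact (Impl.par_list (fun k => Impl.uLocal l k hd) (fun i j h => blockQubits_disjoint h)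
    (List.nodup_finRange n)).mono_right (Finset.subset_univ _)

theorem Impl.hadAnc : Impl 1 Finset.univ (hadAnc n ν) := by
  rw [OrderedPrep.hadAnc, List.ofFn_eq_map]
  exact (Impl.par_list (fun k : Fin n => Impl.gate (Gate.had (Sum.inr k : TotQ n ν)))
    (fun i j h => by simpa [Gate.qubits] using h)
    (List.nodup_finRange n)).mono_right (Finset.subset_univ _)

theorem Impl.uPrep (l : Fin (ν + 1)) {d : ℕ} (hd : 2 * (ν + 1) ≤ 2 ^ d) :
    Impl (4 * d + 11) Finset.univ (uPrep l : Op (TotQ n ν)) :=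
  ((Impl.hadAnc.seq (Impl.uOrd l hd)).seq Impl.hadAnc).mono_left (by omega)

theorem two_mul_succ_le_two_pow (ν : ℕ) : 2 * (ν + 1) ≤ 2 ^ (Nat.log 2 ν + 2) := by
  have := Nat.lt_pow_succ_log_self (b := 2) (by norm_num) ν
  rw [pow_succ]
  omega

/-- The left side is `4 * Nat.log 2 ν + 19`, and `log 2 > 1/2` bounds its first term by `8 *
Real.log ν`. The case `ν = 0` is included, since both logarithms are then zero. -/
theorem depth_le (ν : ℕ) :
    ((4 * (Nat.log 2 ν + 2) + 11 : ℕ) : ℝ) ≤ 19 * (1 + Real.log ν) := by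
  have h0 : 0 ≤ Real.log ν := Real.log_natCast_nonneg ν
  have h1 : (Nat.log 2 ν : ℝ) ≤ Real.log ν / Real.log 2 := by
    simpa [Real.logb] using Real.natLog_le_logb ν 2
  have h2 : Real.log ν / Real.log 2 ≤ 2 * Real.log ν := by
    rw [div_le_iff₀ (Real.log_pos (by norm_num))]
    nlinarith [Real.log_two_gt_d9]
  push_cast
  linarith

end Ordered

end OrderedPrep

/-! ### Assembly of the theorem. -/

theorem mainTheorem6 :
    (∀ (n ν : ℕ) (l : Fin (ν + 1)), l ≠ 0 →
      -- product of local operators on disjoint sets of qubits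
      (cOrd l : Op (SysQ (2 * n) ν)) =
        (((2 : ℝ) ^ (((2 * n : ℕ) : ℝ) / 4) : ℝ) : ℂ)⁻¹ •
          (List.ofFn fun k : Fin n => localC l k - Complex.I • localD l k).prod ∧
      (∀ k : Fin n,
        SupportedOn (localC l k) (pairQubits ν k) ∧ SupportedOn (localD l k) (pairQubits ν k) ∧
        weight (localC l k) ≤ 2 * (ν + 1) ∧ weight (localD l k) ≤ 2 * (ν + 1)) ∧
      (∀ k k' : Fin n, k ≠ k' → Disjoint (pairQubits ν k) (pairQubits ν k')) ∧
      -- the unitary on the system and `N / 2 = n` ancillas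
      (∀ k : Fin n,
        uLocal l k ∈ Matrix.unitaryGroup (Basis (TotQ n ν)) ℂ ∧
        SupportedOn (uLocal l k) (blockQubits ν k)) ∧
      (∀ k k' : Fin n, k ≠ k' → Disjoint (blockQubits ν k) (blockQubits ν k')) ∧
      (uOrd l : Op (TotQ n ν)) ∈ Matrix.unitaryGroup (Basis (TotQ n ν)) ℂ ∧
      (uPrep l : Op (TotQ n ν)) ∈ Matrix.unitaryGroup (Basis (TotQ n ν)) ℂ ∧
      -- measurement of the ancillas, and the sign correction of the stabilizers
      (∀ (ψ : Ket (SysQ (2 * n) ν)) (m : Fin n → Fin 2),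
        afterOutcome (uPrep l *ᵥ withZeroAnc ψ) m = ((2 : ℂ) ^ n)⁻¹ • (signedProd l m *ᵥ ψ) ∧
        ∀ k : Fin n,
          ((-1 : ℂ) ^ (m k : ℕ) • stab l (fstSite k) (sndSite k)) *ᵥ
              afterOutcome (uPrep l *ᵥ withZeroAnc ψ) m =
            afterOutcome (uPrep l *ᵥ withZeroAnc ψ) m) ∧
      (∀ ψ : Ket (SysQ (2 * n) ν),
        afterOutcome (uPrep l *ᵥ withZeroAnc ψ) 0 =
          (((2 : ℝ) ^ (((2 * n : ℕ) : ℝ) / 4) : ℝ) : ℂ)⁻¹ • (cOrd l *ᵥ ψ))) ∧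
    -- circuit depth `O(log ν)`, uniformly in the number of sites and in the auxiliary index
    (∃ K : ℝ, ∀ (n ν : ℕ) (l : Fin (ν + 1)), l ≠ 0 →
      (∃ C : Circuit (TotQ n ν), C.op = uOrd l ∧ (C.depth : ℝ) ≤ K * (1 + Real.log ν)) ∧
      (∃ C : Circuit (TotQ n ν), C.op = uPrep l ∧ (C.depth : ℝ) ≤ K * (1 + Real.log ν))) := by
  refine ⟨fun n ν l _ => ⟨?_, fun k => ⟨localC_supportedOn l k, localD_supportedOn l k, ?_, ?_⟩,
    fun k k' h => pairQubits_disjoint h,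
    fun k => ⟨uLocal_mem_unitary l k, uLocal_supportedOn l k⟩, fun k k' h => blockQubits_disjoint h,
    uOrd_mem_unitary l, uPrep_mem_unitary l,
    fun ψ m => ⟨afterOutcome_uPrep l ψ m, fun k => ?_⟩, fun ψ => ?_⟩,
    19, fun n ν l _ => ?_⟩
  · rw [cOrd_eq_signedProd, signedProd_eq]
    simp
  · exact (weight_le_card (localC_supportedOn l k)).trans (card_pairQubits k).le
  · exact (weight_le_card (localD_supportedOn l k)).trans (card_pairQubits k).le
  · rw [afterOutcome_uPrep, Matrix.mulVec_smul, Matrix.mulVec_mulVec, smul_stab_mul_signedProd]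
  · rw [afterOutcome_uPrep, cOrd_eq_signedProd, Matrix.smul_mulVec, smul_smul, two_rpow_mul_self]
  -- The tree depth is `d = Nat.log 2 ν + 2`, enough for the `2 * (ν + 1)` qubits of a pair. The
  -- bound for `uPrep` also covers `uOrd`, which is two layers shorter.
  · have hd := two_mul_succ_le_two_pow ν
    obtain ⟨C, hC, hCd, -⟩ := Impl.uOrd (n := n) l hd
    obtain ⟨C', hC', hCd', -⟩ := Impl.uPrep (n := n) l hd
    refine ⟨⟨C, hC, le_trans ?_ (depth_le ν)⟩, ⟨C', hC', le_trans ?_ (depth_le ν)⟩⟩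
    · rw [hCd]
      exact_mod_cast Nat.add_le_add_left (by norm_num) _
    · rw [hCd']
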